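/- Let $k$ be a field, let $d\ge 1$ be an integer, and let $A$ be a $d$-representation infinite $k$-algebra. Here, for $n\ge 0$, a finite dimensional $k$-algebra $B$ is called $n$-representation infinite if $\operatorname{gl.dim} B\le n$ and, for all $i\ge 0$, $$\nu_n^{-i}(B)\in \operatorname{mod} B\subset \mathrm{D}^{\mathrm b}(\operatorname{mod} B),$$ where $\operatorname{mod} B$ is the category of finitely generated right $B$-modules (viewed as complexes concentrated in degree $0$), $D=\operatorname{Hom}_k(-,k)$, and $\nu_n^{-1}=\mathbf{R}\operatorname{Hom}_B(DB,-)[n]$ is the inverse of the shifted Serre functor $\nu_n=-\otimes^{\mathbf L}_B DB[-n]$. Let $e\in A$ be an idempotent, let $(e)=AeA$ be the two-sided ideal generated by $e$, and suppose that 1. $(1-e)Ae=0$; 2. the right $A$-module $D(A/(e))$ has projective dimension $\operatorname{pd}_A D(A/(e))<d$; 3. $eAe$ is a semisimple algebra. Then the algebra $A/(e)$ is $(d-1)$-representation infinite. -/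

import Mathlib

open CategoryTheory MulOpposite

universe u

/-! Right modules over a ring `A` are modules over the opposite ring `Aᵐᵒᵖ`. -/

section Dual

variable (k A : Type u) [Field k] [Ring A] [Algebra k A]

/-- The `k`-dual `DA = Hom_k(A, k)` of a `k`-algebra `A`, with its `A`-`A`-bimodule structure. -/
def KDual : Type u := A →ₗ[k] k

namespace KDual

noncomputable instance : AddCommGroup (KDual k A) := inferInstanceAs (AddCommGroup (A →ₗ[k] k))

/-- The right action on `DA`: `(f · a)(x) = f (a x)`. -/
noncomputable instance : Module Aᵐᵒᵖ (KDual k A) where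
  smul a f := LinearMap.comp (show A →ₗ[k] k from f) (LinearMap.mulLeft k a.unop)
  one_smul f := LinearMap.ext fun x => congrArg (show A →ₗ[k] k from f) (one_mul x)
  mul_smul a b f := LinearMap.ext fun x =>
    congrArg (show A →ₗ[k] k from f) (mul_assoc b.unop a.unop x)
  smul_zero _ := rfl
  smul_add _ _ _ := rfl
  add_smul a b f := LinearMap.ext fun x =>
    (congrArg (show A →ₗ[k] k from f) (add_mul a.unop b.unop x)).trans (map_add _ _ _)
  zero_smul f := LinearMap.ext fun x =>
    (congrArg (show A →ₗ[k] k from f) (zero_mul x)).trans (map_zero _)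

/-- The left action on `DA`: `(a · f)(x) = f (x a)`. -/
noncomputable instance : Module A (KDual k A) where
  smul a f := LinearMap.comp (show A →ₗ[k] k from f) (LinearMap.mulRight k a)
  one_smul f := LinearMap.ext fun x => congrArg (show A →ₗ[k] k from f) (mul_one x)
  mul_smul a b f := LinearMap.ext fun x =>
    congrArg (show A →ₗ[k] k from f) (mul_assoc x a b).symm
  smul_zero _ := rfl
  smul_add _ _ _ := rfl
  add_smul a b f := LinearMap.ext fun x =>
    (congrArg (show A →ₗ[k] k from f) (mul_add x a b)).trans (map_add _ _ _)
  zero_smul f := LinearMap.ext fun x =>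
    (congrArg (show A →ₗ[k] k from f) (mul_zero x)).trans (map_zero _)

instance : SMulCommClass A Aᵐᵒᵖ (KDual k A) where
  smul_comm a b f := LinearMap.ext fun x =>
    congrArg (show A →ₗ[k] k from f) (mul_assoc b.unop x a).symm

/-- Left multiplication by `a` on `DA`, as an endomorphism of the right `A`-module `DA`. -/
noncomputable def leftMul (a : A) : KDual k A →ₗ[Aᵐᵒᵖ] KDual k A where
  toFun f := a • f
  map_add' f g := smul_add a f g
  map_smul' b f := smul_comm a b f

end KDual

/-- `Hom_A(DA, X)` for a right `A`-module `X`, where `DA` is viewed as a right `A`-module. -/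
def HomKDual (X : Type u) [AddCommGroup X] [Module Aᵐᵒᵖ X] : Type u := KDual k A →ₗ[Aᵐᵒᵖ] X

namespace HomKDual

variable (X : Type u) [AddCommGroup X] [Module Aᵐᵒᵖ X]

noncomputable instance : AddCommGroup (HomKDual k A X) :=
  inferInstanceAs (AddCommGroup (KDual k A →ₗ[Aᵐᵒᵖ] X))

/-- The right action on `Hom_A(DA, X)` induced by the left action on `DA`:
`(φ · a)(f) = φ (a · f)`. -/
noncomputable instance : Module Aᵐᵒᵖ (HomKDual k A X) where
  smul a φ := LinearMap.comp (show KDual k A →ₗ[Aᵐᵒᵖ] X from φ) (KDual.leftMul k A a.unop)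
  one_smul φ := LinearMap.ext fun f =>
    congrArg (show KDual k A →ₗ[Aᵐᵒᵖ] X from φ) (one_smul A f)
  mul_smul a b φ := LinearMap.ext fun f =>
    congrArg (show KDual k A →ₗ[Aᵐᵒᵖ] X from φ) (mul_smul b.unop a.unop f)
  smul_zero _ := rfl
  smul_add _ _ _ := rfl
  add_smul a b φ := LinearMap.ext fun f =>
    (congrArg (show KDual k A →ₗ[Aᵐᵒᵖ] X from φ) (add_smul a.unop b.unop f)).trans (map_add _ _ _)
  zero_smul φ := LinearMap.ext fun f =>
    (congrArg (show KDual k A →ₗ[Aᵐᵒᵖ] X from φ) (zero_smul A f)).trans (map_zero _)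

end HomKDual

/-- The functor `Hom_A(DA, -)` from right `A`-modules to right `A`-modules. -/
noncomputable def homKDualFunctor : ModuleCat.{u} Aᵐᵒᵖ ⥤ ModuleCat.{u} Aᵐᵒᵖ where
  obj X := ModuleCat.of Aᵐᵒᵖ (HomKDual k A X)
  map {X Y} g := ModuleCat.ofHom
    { toFun := fun (φ : HomKDual k A X) =>
        (LinearMap.comp g.hom (show KDual k A →ₗ[Aᵐᵒᵖ] X from φ) : HomKDual k A Y)
      map_add' := fun φ ψ => LinearMap.comp_add (show KDual k A →ₗ[Aᵐᵒᵖ] X from φ)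
        (show KDual k A →ₗ[Aᵐᵒᵖ] X from ψ) g.hom
      map_smul' := fun _ _ => rfl }
  map_id _ := rfl
  map_comp _ _ := rfl

instance : (homKDualFunctor k A).Additive where
  map_add := rfl

end Dual

section RepresentationInfinite

attribute [local instance] HasDerivedCategory.standard

variable (k A : Type u) [Field k] [Ring A] [Algebra k A]

/-- The inverse shifted Serre functor `ν_n⁻¹ = RHom_A(DA, -)[n]`, on the bounded below derived
category of right `A`-modules (which contains the bounded derived category of finite dimensional
right `A`-modules as a full subcategory). -/
noncomputable def nuInv (n : ℕ) :
    DerivedCategory.Plus (ModuleCat.{u} Aᵐᵒᵖ) ⥤ DerivedCategory.Plus (ModuleCat.{u} Aᵐᵒᵖ) :=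
  (homKDualFunctor k A).rightDerivedFunctorPlus ⋙
    shiftFunctor (DerivedCategory.Plus (ModuleCat.{u} Aᵐᵒᵖ)) (n : ℤ)

/-- An object of the derived category lies in `mod A`: it is isomorphic to a finitely generated
right `A`-module placed in degree `0`. -/
def InModCat (X : DerivedCategory.Plus (ModuleCat.{u} Aᵐᵒᵖ)) : Prop :=
  ∃ M : ModuleCat.{u} Aᵐᵒᵖ, Module.Finite Aᵐᵒᵖ M ∧
    Nonempty (X ≅ (DerivedCategory.Plus.singleFunctor (ModuleCat.{u} Aᵐᵒᵖ) 0).obj M)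

/-- `A` is `n`-representation infinite: `A` is a finite dimensional `k`-algebra of (right) global
dimension at most `n`, and `ν_n^{-i} A ∈ mod A` for all `i ≥ 0`. -/
structure IsRepresentationInfinite (n : ℕ) : Prop where
  finiteDimensional : Module.Finite k A
  gldim_le : ∀ M : ModuleCat.{u} Aᵐᵒᵖ, HasProjectiveDimensionLE M n
  nuInv_iterate_mem : ∀ i : ℕ, InModCat A ((nuInv k A n).obj^[i]
    ((DerivedCategory.Plus.singleFunctor (ModuleCat.{u} Aᵐᵒᵖ) 0).obj (ModuleCat.of Aᵐᵒᵖ A)))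

end RepresentationInfinite

section IdempotentQuotient

variable {A : Type u} [Ring A]

/-- The quotient algebra `A/(e)` by the two-sided ideal generated by `e`. -/
abbrev IdempotentQuotient (e : A) : Type u := A ⧸ (TwoSidedIdeal.span {e}).asIdeal

/-- `D(A/(e))` as a right `A`-module, through the projection `A → A/(e)`. -/
noncomputable def dualIdempotentQuotient (k : Type u) [Field k] [Algebra k A] (e : A) :
    ModuleCat.{u} Aᵐᵒᵖ :=
  (ModuleCat.restrictScalars
    (RingHom.op (Ideal.Quotient.mk (TwoSidedIdeal.span {e}).asIdeal))).obj
    (ModuleCat.of (IdempotentQuotient e)ᵐᵒᵖ (KDual k (IdempotentQuotient e)))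

end IdempotentQuotient

/-!
Write `B = A/(e)` and `d = n + 1`. Since `(1 - e) A e = 0`, the ideal `(e)` equals `eA`, so `B` is
projective as a right `A`-module and the coextension functor `Hom_A(B, -)` is exact.

Global dimension: projective dimensions over `B` are at most those over `A`
(`hasProjectiveDimensionLT_of_restrictScalars`), and every `B`-module embeds in a direct sum of
copies of `DB`, which has projective dimension at most `n`. As all projective dimensions are at most
`n + 1`, a dimension shift gives `gl.dim B ≤ n` (`hasProjectiveDimensionLE_of_kDual`).

Iterates of `ν⁻¹`: let `M` be a `B`-module and `L` an injective resolution of `M` over `A`. Then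
`Hom_A(B, L)` is an injective resolution of `M` over `B`, and restriction along `DB ⊆ DA` gives an
exact sequence of complexes of right `A`-modules
`0 → Hom_A(DA, L) e A → Hom_A(DA, L) → Hom_B(DB, Hom_A(B, L)) → 0` (`traceSequence`). The terms of
`Hom_A(DA, L)` are projective, and since `eAe` is semisimple the differentials of the subcomplex are
von Neumann regular, so its cohomology is projective and generated by its `e`-part
(`homology_idemTrace`). The cohomology of the third term is killed by `e`. If `ν_{n+1}⁻¹ M` is a
finitely generated `A`-module, comparing degrees shows that `ν_n⁻¹ M`, formed over `B`, is a module
`M'` and that there is an exact sequence `0 → M' → P → ν_{n+1}⁻¹ M → 0` over `A` with `P` finitely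
generated projective (`exists_shortExact_nuInv`).

Call an object stable for `A` if all its iterates under `ν_{n+1}⁻¹` lie in `mod A`. Finitely
generated projectives are stable, and in the last sequence stability of `M` implies that of `M'`
(`NuInvStable.of_distTriang₁`): each iterate of `M'` could have cohomology only in degrees `0` and
`1`, and `gl.dim A ≤ n + 1` excludes degree `1`. Starting from `M = B`, which is projective over
`A`, the iterates of `ν_n⁻¹` on `B` are thus modules (`NuInvStable.of_restrictScalars`).
-/

open Limits Pretriangulated Triangulated

/-! ### Derived functors and cohomology in the bounded below derived category -/

section RightDerived

variable {C D : Type*} [Category* C] [Category* D] [Abelian C] [Abelian D]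
  [HasDerivedCategory C] [HasDerivedCategory D] [EnoughInjectives C]

/-- The total right derived functor is computed termwise on bounded below complexes of
injectives. -/
lemma rightDerivedFunctorPlus_injective (F : C ⥤ D) [F.Additive] (X : DerivedCategory.Plus C)
    (L : CochainComplex C ℤ) (n : ℤ) [L.IsStrictlyGE n] [∀ i, Injective (L.X i)]
    (e : DerivedCategory.Q.obj L ≅ X.obj) :
    Nonempty ((F.rightDerivedFunctorPlus.obj X).obj ≅
      DerivedCategory.Q.obj ((F.mapHomologicalComplex (.up ℤ)).obj L)) := by
  let L' : CochainComplex (InjectiveObject C) ℤ :=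
    HomologicalComplex.liftObjectProperty _ L inferInstance
  have hL' : L'.IsStrictlyGE n := by
    rwa [← CochainComplex.isStrictlyGE_mapHomologicalComplex_obj_iff _ (InjectiveObject.ι _)]
  let K : CochainComplex.Plus (InjectiveObject C) := ⟨L', n, hL'⟩
  let e' : DerivedCategory.Plus.Q.obj ((InjectiveObject.ι C).mapCochainComplexPlus.obj K) ≅ X :=
    DerivedCategory.Plus.ι.preimageIso e
  have : IsIso (F.rightDerivedFunctorPlusUnit.app
      ((HomotopyCategory.Plus.quotient C).obj
        ((InjectiveObject.ι C).mapCochainComplexPlus.obj K))) := inferInstance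
  exact ⟨DerivedCategory.Plus.ι.mapIso (F.rightDerivedFunctorPlus.mapIso e'.symm ≪≫
    (asIso (F.rightDerivedFunctorPlusUnit.app
      ((HomotopyCategory.Plus.quotient C).obj
        ((InjectiveObject.ι C).mapCochainComplexPlus.obj K)))).symm)⟩

/-- The total right derived functor preserves distinguished triangles. It is enough to know this
objectwise, without compatibilities between the isomorphisms: replace the first morphism by one
between complexes of injectives, and take its cone there. -/
lemma exists_distTriang_rightDerivedFunctorPlus (F : C ⥤ D) [F.Additive]
    (T : Triangle (DerivedCategory.Plus C)) (hT : T ∈ distTriang _) :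
    ∃ T' ∈ distTriang (DerivedCategory.Plus D),
      Nonempty (T'.obj₁ ≅ F.rightDerivedFunctorPlus.obj T.obj₁) ∧
      Nonempty (T'.obj₂ ≅ F.rightDerivedFunctorPlus.obj T.obj₂) ∧
      Nonempty (T'.obj₃ ≅ F.rightDerivedFunctorPlus.obj T.obj₃) := by
  let N := (InjectiveObject.ι C).mapHomotopyCategoryPlus
  have hN : ∀ X : DerivedCategory.Plus C, ∃ K : HomotopyCategory.Plus (InjectiveObject C),
      Nonempty (DerivedCategory.Plus.Qh.obj (N.obj K) ≅ X) := by
    intro X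
    obtain ⟨n, hn⟩ := X.property
    have : X.IsGE n := (DerivedCategory.Plus.isGE_ι_obj_iff X n).1 hn
    obtain ⟨L, _, ⟨e⟩⟩ := DerivedCategory.Plus.exists_injective_nonempty_iso X n
    exact ⟨(HomotopyCategory.Plus.quotient _).obj L, ⟨e⟩⟩
  obtain ⟨K₁, ⟨e₁⟩⟩ := hN T.obj₁
  obtain ⟨K₂, ⟨e₂⟩⟩ := hN T.obj₂
  have hinj : CochainComplex.IsKInjective (N.obj K₂).1.as := by
    obtain ⟨L, rfl⟩ := HomotopyCategory.Plus.quotient_obj_surjective K₂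
    exact inferInstanceAs (CochainComplex.IsKInjective
      (((InjectiveObject.ι C).mapHomologicalComplex (.up ℤ)).obj L.obj))
  obtain ⟨g, hg⟩ := (DerivedCategory.Plus.Qh_map_bijective_of_isKInjective
    (N.obj K₁) (N.obj K₂) hinj).2 (e₁.hom ≫ T.mor₁ ≫ e₂.inv)
  obtain ⟨g, rfl⟩ := N.map_surjective g
  obtain ⟨K₃, a, b, mem⟩ := distinguished_cocone_triangle g
  have mem' := N.map_distinguished _ mem
  have h1 := DerivedCategory.Plus.Qh.map_distinguished _ mem'
  have h2 := DerivedCategory.Plus.Qh.map_distinguished _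
    (F.mapHomotopyCategoryPlus.map_distinguished _ mem')
  obtain ⟨e₃⟩ : Nonempty (DerivedCategory.Plus.Qh.obj (N.obj K₃) ≅ T.obj₃) :=
    ⟨Triangle.π₃.mapIso (isoTriangleOfIso₁₂ _ _ h1 hT e₁ e₂ (by
      change DerivedCategory.Plus.Qh.map (N.map g) ≫ e₂.hom = _
      simp only [hg, Category.assoc, e₂.inv_hom_id, Category.comp_id]
      rfl))⟩
  -- the unit of the derived functor is invertible on complexes of injectives
  have E : ∀ (K : HomotopyCategory.Plus (InjectiveObject C)) (X : DerivedCategory.Plus C),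
      (DerivedCategory.Plus.Qh.obj (N.obj K) ≅ X) →
      Nonempty (DerivedCategory.Plus.Qh.obj (F.mapHomotopyCategoryPlus.obj (N.obj K)) ≅
        F.rightDerivedFunctorPlus.obj X) := by
    intro K X e
    have : IsIso (F.rightDerivedFunctorPlusUnit.app (N.obj K)) := inferInstance
    exact ⟨asIso (F.rightDerivedFunctorPlusUnit.app (N.obj K)) ≪≫
      F.rightDerivedFunctorPlus.mapIso e⟩
  exact ⟨_, h2, E _ _ e₁, E _ _ e₂, E _ _ e₃⟩

end RightDerived

section Homology

variable {C : Type*} [Category* C] [Abelian C] [HasDerivedCategory C]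

open DerivedCategory.Plus

/-- The part `Hⁱ(T₃) → Hʲ(T₁) → Hʲ(T₂) → Hʲ(T₃)`, `j = i + 1`, of the long exact sequence of a
distinguished triangle. -/
lemma exists_homologyFunctor_exact (T : Triangle (DerivedCategory.Plus C)) (hT : T ∈ distTriang _)
    (i j : ℤ) (h : i + 1 = j) :
    ∃ (δ : (homologyFunctor C i).obj T.obj₃ ⟶ (homologyFunctor C j).obj T.obj₁)
      (w : δ ≫ (homologyFunctor C j).map T.mor₁ = 0)
      (w' : (homologyFunctor C j).map T.mor₁ ≫ (homologyFunctor C j).map T.mor₂ = 0),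
      (ShortComplex.mk _ _ w).Exact ∧ (ShortComplex.mk _ _ w').Exact := by
  have hT' := DerivedCategory.Plus.ι.map_distinguished T hT
  exact ⟨_, _, _, DerivedCategory.HomologySequence.exact₁ _ hT' i j h,
    DerivedCategory.HomologySequence.exact₂ _ hT' j⟩

/-- The isomorphism `Hⁱ(X[n]) ≅ Hⁿ⁺ⁱ(X)`. -/
noncomputable def homologyShiftIso (X : DerivedCategory.Plus C) (n i j : ℤ) (h : n + i = j) :
    (homologyFunctor C i).obj (X⟦n⟧) ≅ (homologyFunctor C j).obj X :=
  (DerivedCategory.homologyFunctor C i).mapIso ((DerivedCategory.Plus.ι.commShiftIso n).app X) ≪≫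
    ((DerivedCategory.homologyFunctor C 0).shiftIso n i j h).app X.obj

/-- The isomorphism `H⁰(M) ≅ M` for an object `M` placed in degree `0`. -/
noncomputable def homologySingleIso (M : C) :
    (homologyFunctor C 0).obj ((singleFunctor C 0).obj M) ≅ M :=
  (DerivedCategory.singleFunctorCompHomologyFunctorIso C 0).app M

lemma isZero_homology_single (M : C) (j : ℤ) (hj : j ≠ 0) :
    IsZero ((homologyFunctor C j).obj ((singleFunctor C 0).obj M)) := by
  rcases lt_or_gt_of_ne hj with h | h
  · exact isZero_homology_of_isGE _ 0 j h
  · exact isZero_homology_of_isLE _ 0 j h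

lemma exists_iso_single_of_isZero_homology (X : DerivedCategory.Plus C)
    (h : ∀ j : ℤ, j ≠ 0 → IsZero ((homologyFunctor C j).obj X)) :
    Nonempty (X ≅ (singleFunctor C 0).obj ((homologyFunctor C 0).obj X)) := by
  have h1 : X.obj.IsGE 0 := (DerivedCategory.isGE_iff _ _).2 fun i hi => h i hi.ne
  have h2 : X.obj.IsLE 0 := (DerivedCategory.isLE_iff _ _).2 fun i hi => h i hi.ne'
  obtain ⟨Y, ⟨e⟩⟩ := DerivedCategory.exists_iso_singleFunctor_obj_of_isGE_of_isLE X.obj 0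
  let e' : X ≅ (singleFunctor C 0).obj Y := DerivedCategory.Plus.ι.preimageIso e
  exact ⟨e' ≪≫ (singleFunctor C 0).mapIso ((homologyFunctor C 0).mapIso e' ≪≫
    homologySingleIso Y).symm⟩

/-- A short exact sequence gives a distinguished triangle in the bounded below derived category. -/
lemma exists_distTriang_single {S : ShortComplex C} (hS : S.ShortExact) :
    ∃ T ∈ distTriang (DerivedCategory.Plus C), T.obj₁ = (singleFunctor C 0).obj S.X₁ ∧
      T.obj₂ = (singleFunctor C 0).obj S.X₂ ∧ T.obj₃ = (singleFunctor C 0).obj S.X₃ := by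
  have key : ∀ (X Y : DerivedCategory.Plus C)
      (f : DerivedCategory.Plus.ι.obj X ⟶ (DerivedCategory.Plus.ι.obj Y)⟦(1 : ℤ)⟧),
      ∃ δ : X ⟶ Y⟦(1 : ℤ)⟧, DerivedCategory.Plus.ι.map δ ≫
        (DerivedCategory.Plus.ι.commShiftIso (1 : ℤ)).hom.app Y = f := fun X Y f =>
    ⟨DerivedCategory.Plus.ι.preimage
      (f ≫ (DerivedCategory.Plus.ι.commShiftIso (1 : ℤ)).inv.app Y), by
        rw [Functor.map_preimage, Category.assoc, Iso.inv_hom_id_app]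
        exact Category.comp_id _⟩
  obtain ⟨δ, hδ⟩ := key ((singleFunctor C 0).obj S.X₃) ((singleFunctor C 0).obj S.X₁) hS.singleδ
  let T : Triangle (DerivedCategory.Plus C) := Triangle.mk
    ((singleFunctor C 0).map S.f) ((singleFunctor C 0).map S.g) δ
  refine ⟨T, ?_, rfl, rfl, rfl⟩
  rw [← DerivedCategory.Plus.ι.map_distinguished_iff]
  refine isomorphic_distinguished _ hS.singleTriangle_distinguished _ ?_
  refine Triangle.isoMk _ _ (Iso.refl _) (Iso.refl _) (Iso.refl _) ?_ ?_ ?_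
  · exact (Category.comp_id _).trans (Category.id_comp _).symm
  · exact (Category.comp_id _).trans (Category.id_comp _).symm
  · refine (congrArg (fun t => (DerivedCategory.Plus.ι.mapTriangle.obj T).mor₃ ≫ t)
      (CategoryTheory.Functor.map_id (shiftFunctor (DerivedCategory C) (1 : ℤ)) _)).trans ?_
    exact (Category.comp_id _).trans (hδ.trans (Category.id_comp _).symm)

end Homology

/-! ### Objects of `mod A` and the inverse Serre functor -/

section InModCat

attribute [local instance] HasDerivedCategory.standard

open DerivedCategory.Plus

variable {A : Type u} [Ring A]

lemma inModCat_iff (X : DerivedCategory.Plus (ModuleCat.{u} Aᵐᵒᵖ)) :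
    InModCat A X ↔
      (∀ j : ℤ, j ≠ 0 → IsZero ((homologyFunctor (ModuleCat.{u} Aᵐᵒᵖ) j).obj X)) ∧
        Module.Finite Aᵐᵒᵖ ((homologyFunctor (ModuleCat.{u} Aᵐᵒᵖ) 0).obj X) := by
  constructor
  · rintro ⟨M, hM, ⟨e⟩⟩
    refine ⟨fun j hj => (isZero_homology_single M j hj).of_iso ((homologyFunctor _ j).mapIso e), ?_⟩
    exact Module.Finite.equiv
      ((homologyFunctor _ 0).mapIso e ≪≫ homologySingleIso M).symm.toLinearEquiv
  · rintro ⟨h, h'⟩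
    exact ⟨_, h', exists_iso_single_of_isZero_homology X h⟩

lemma InModCat.of_iso {X Y : DerivedCategory.Plus (ModuleCat.{u} Aᵐᵒᵖ)} (h : InModCat A X)
    (e : X ≅ Y) : InModCat A Y := by
  obtain ⟨M, hM, ⟨e'⟩⟩ := h
  exact ⟨M, hM, ⟨e.symm ≪≫ e'⟩⟩

lemma InModCat.of_retract {X Y : DerivedCategory.Plus (ModuleCat.{u} Aᵐᵒᵖ)} (h : InModCat A X)
    (r : Retract Y X) : InModCat A Y := by
  rw [inModCat_iff] at h ⊢
  refine ⟨fun j hj => ?_, ?_⟩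
  · let rj := r.map (homologyFunctor (ModuleCat.{u} Aᵐᵒᵖ) j)
    exact IsZero.of_mono_eq_zero rj.i ((h.1 j hj).eq_of_tgt _ _)
  have := h.2
  let r0 := r.map (homologyFunctor (ModuleCat.{u} Aᵐᵒᵖ) 0)
  exact Module.Finite.of_surjective r0.r.hom fun y =>
    ⟨r0.i.hom y, congrArg (fun f => f.hom y) r0.retract⟩

lemma inModCat_single_iff (M : ModuleCat.{u} Aᵐᵒᵖ) :
    InModCat A ((singleFunctor _ 0).obj M) ↔ Module.Finite Aᵐᵒᵖ M := by
  refine ⟨fun h => ?_, fun h => ⟨M, h, ⟨Iso.refl _⟩⟩⟩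
  have := ((inModCat_iff _).1 h).2
  exact Module.Finite.equiv (homologySingleIso M).toLinearEquiv

lemma InModCat.of_distTriang₂ [IsNoetherianRing Aᵐᵒᵖ]
    {T : Triangle (DerivedCategory.Plus (ModuleCat.{u} Aᵐᵒᵖ))}
    (hT : T ∈ distTriang _) (h₁ : InModCat A T.obj₁) (h₃ : InModCat A T.obj₃) :
    InModCat A T.obj₂ := by
  rw [inModCat_iff] at h₁ h₃ ⊢
  refine ⟨fun j hj => ?_, ?_⟩
  · obtain ⟨-, -, w, -, ex⟩ := exists_homologyFunctor_exact T hT (j - 1) j (by lia)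
    exact ex.isZero_of_both_zeros ((h₁.1 j hj).eq_of_src _ _) ((h₃.1 j hj).eq_of_tgt _ _)
  · obtain ⟨-, -, w, -, ex⟩ := exists_homologyFunctor_exact T hT (0 - 1) 0 (by lia)
    obtain ⟨-, h₁⟩ := h₁
    obtain ⟨-, h₃⟩ := h₃
    have := isNoetherian_of_range_eq_ker _ _ ex.moduleCat_range_eq_ker
    infer_instance

/-- In the long exact sequence, `X₁` can have cohomology in degrees `0` and `1` only; the second is
excluded by hypothesis. -/
lemma InModCat.of_distTriang₁ [IsNoetherianRing Aᵐᵒᵖ]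
    {T : Triangle (DerivedCategory.Plus (ModuleCat.{u} Aᵐᵒᵖ))}
    (hT : T ∈ distTriang _) (h₂ : InModCat A T.obj₂) (h₃ : InModCat A T.obj₃)
    (h₁ : IsZero ((homologyFunctor (ModuleCat.{u} Aᵐᵒᵖ) 1).obj T.obj₁)) :
    InModCat A T.obj₁ := by
  rw [inModCat_iff] at h₂ h₃ ⊢
  refine ⟨fun j hj => ?_, ?_⟩
  · by_cases hj' : j = 1
    · subst hj'
      exact h₁
    · obtain ⟨δ, w, -, ex, -⟩ := exists_homologyFunctor_exact T hT (j - 1) j (by lia)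
      exact ex.isZero_of_both_zeros ((h₃.1 _ (by lia)).eq_of_src _ _)
        ((h₂.1 j hj).eq_of_tgt _ _)
  · obtain ⟨δ, w, -, ex, -⟩ := exists_homologyFunctor_exact T hT (0 - 1) 0 (by lia)
    have hm : Mono ((homologyFunctor (ModuleCat.{u} Aᵐᵒᵖ) 0).map T.mor₁) :=
      ex.mono_g ((h₃.1 _ (by lia)).eq_of_src _ _)
    have := h₂.2
    exact Module.Finite.of_injective _ ((ModuleCat.mono_iff_injective _).1 hm)

end InModCat

section NuInv

attribute [local instance] HasDerivedCategory.standard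

open DerivedCategory.Plus

variable (k A : Type u) [Field k] [Ring A] [Algebra k A]

lemma nuInv_iterate_iso (n i : ℕ) {X Y : DerivedCategory.Plus (ModuleCat.{u} Aᵐᵒᵖ)} (e : X ≅ Y) :
    Nonempty ((nuInv k A n).obj^[i] X ≅ (nuInv k A n).obj^[i] Y) := by
  induction i generalizing X Y with
  | zero => exact ⟨e⟩
  | succ i ih => exact ih ((nuInv k A n).mapIso e)

lemma nuInv_iterate_retract (n i : ℕ) {X Y : DerivedCategory.Plus (ModuleCat.{u} Aᵐᵒᵖ)}
    (r : Retract X Y) :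
    Nonempty (Retract ((nuInv k A n).obj^[i] X) ((nuInv k A n).obj^[i] Y)) := by
  induction i generalizing X Y with
  | zero => exact ⟨r⟩
  | succ i ih => exact ih (r.map (nuInv k A n))

lemma exists_distTriang_nuInv_iterate (n i : ℕ)
    (T : Triangle (DerivedCategory.Plus (ModuleCat.{u} Aᵐᵒᵖ))) (hT : T ∈ distTriang _) :
    ∃ T' ∈ distTriang (DerivedCategory.Plus (ModuleCat.{u} Aᵐᵒᵖ)),
      Nonempty (T'.obj₁ ≅ (nuInv k A n).obj^[i] T.obj₁) ∧
      Nonempty (T'.obj₂ ≅ (nuInv k A n).obj^[i] T.obj₂) ∧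
      Nonempty (T'.obj₃ ≅ (nuInv k A n).obj^[i] T.obj₃) := by
  induction i with
  | zero => exact ⟨T, hT, ⟨Iso.refl _⟩, ⟨Iso.refl _⟩, ⟨Iso.refl _⟩⟩
  | succ i ih =>
    obtain ⟨T₁, hT₁, ⟨e₁⟩, ⟨e₂⟩, ⟨e₃⟩⟩ := ih
    obtain ⟨T₂, hT₂, ⟨f₁⟩, ⟨f₂⟩, ⟨f₃⟩⟩ :=
      exists_distTriang_rightDerivedFunctorPlus (homKDualFunctor k A) T₁ hT₁
    let s := shiftFunctor (DerivedCategory.Plus (ModuleCat.{u} Aᵐᵒᵖ)) (n : ℤ)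
    simp only [Function.iterate_succ_apply']
    exact ⟨_, Triangle.shift_distinguished T₂ hT₂ (n : ℤ),
      ⟨s.mapIso f₁ ≪≫ (nuInv k A n).mapIso e₁⟩, ⟨s.mapIso f₂ ≪≫ (nuInv k A n).mapIso e₂⟩,
      ⟨s.mapIso f₃ ≪≫ (nuInv k A n).mapIso e₃⟩⟩

/-- The isomorphism `Hⁱ(ν_n⁻¹ X) ≅ Hⁿ⁺ⁱ(RHom(DA, X))`. -/
noncomputable def homologyNuInvIso (n : ℕ) (i j : ℤ) (h : n + i = j)
    (X : DerivedCategory.Plus (ModuleCat.{u} Aᵐᵒᵖ)) :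
    (homologyFunctor (ModuleCat.{u} Aᵐᵒᵖ) i).obj ((nuInv k A n).obj X) ≅
      (homologyFunctor (ModuleCat.{u} Aᵐᵒᵖ) j).obj
        ((homKDualFunctor k A).rightDerivedFunctorPlus.obj X) :=
  homologyShiftIso _ n i j h

end NuInv

section Vanishing

variable {C D : Type*} [Category* C] [Category* D] [Abelian C] [Abelian D]
  [HasDerivedCategory C] [HasDerivedCategory D] [EnoughInjectives C]

open DerivedCategory.Plus

lemma isZero_homology_rightDerivedFunctorPlus_of_injective (F : C ⥤ D) [F.Additive] (M : C)
    [Injective M] (j : ℤ) (hj : j ≠ 0) :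
    IsZero ((homologyFunctor D j).obj
      (F.rightDerivedFunctorPlus.obj ((singleFunctor C 0).obj M))) := by
  let L := (HomologicalComplex.single C (.up ℤ) 0).obj M
  have hz : ∀ i : ℤ, i ≠ 0 → IsZero (L.X i) := fun i hi =>
    HomologicalComplex.isZero_single_obj_X _ _ _ _ hi
  have : ∀ i, Injective (L.X i) := fun i => by
    by_cases hi : i = 0
    · subst hi
      exact Injective.of_iso (HomologicalComplex.singleObjXSelf (.up ℤ) 0 M).symm ‹_›
    · exact (hz i hi).injective
  obtain ⟨e'⟩ := rightDerivedFunctorPlus_injective F ((singleFunctor C 0).obj M) L 0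
    ((DerivedCategory.singleFunctorIsoCompQ C 0).app M).symm
  refine IsZero.of_iso ?_ ((DerivedCategory.homologyFunctor D j).mapIso e' ≪≫
    (DerivedCategory.homologyFunctorFactors D j).app _)
  refine HomologicalComplex.ExactAt.isZero_homology ?_
  exact ShortComplex.exact_of_isZero_X₂ _ (F.map_isZero (hz j hj))

lemma isZero_homology_rightDerivedFunctorPlus_of_hasInjectiveDimensionLT (F : C ⥤ D) [F.Additive]
    (n : ℕ) (M : C) [HasInjectiveDimensionLT M (n + 1)] (j : ℤ) (hj : n < j) :
    IsZero ((homologyFunctor D j).obj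
      (F.rightDerivedFunctorPlus.obj ((singleFunctor C 0).obj M))) := by
  induction n generalizing M j with
  | zero =>
    have : Injective M := injective_iff_hasInjectiveDimensionLT_one.2 ‹_›
    exact isZero_homology_rightDerivedFunctorPlus_of_injective F M j (by lia)
  | succ n ih =>
    let S := ShortComplex.mk (Injective.ι M) (cokernel.π (Injective.ι M)) (cokernel.condition _)
    have hS : S.ShortExact := { exact := ShortComplex.exact_cokernel _ }
    have : HasInjectiveDimensionLT S.X₃ (n + 1) :=
      (hS.hasInjectiveDimensionLT_X₃_iff n (inferInstanceAs (Injective (Injective.under M)))).2 ‹_›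
    obtain ⟨T, hT, h₁, h₂, h₃⟩ := exists_distTriang_single hS
    obtain ⟨T', hT', ⟨e₁⟩, ⟨e₂⟩, ⟨e₃⟩⟩ := exists_distTriang_rightDerivedFunctorPlus F T hT
    obtain ⟨δ, w, -, ex, -⟩ := exists_homologyFunctor_exact T' hT' (j - 1) j (by lia)
    rw [h₁] at e₁
    rw [h₂] at e₂
    rw [h₃] at e₃
    refine IsZero.of_iso ?_ ((homologyFunctor D j).mapIso e₁).symm
    refine ex.isZero_of_both_zeros (IsZero.eq_of_src ?_ _ _) (IsZero.eq_of_tgt ?_ _ _)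
    · exact (ih S.X₃ (j - 1) (by lia)).of_iso ((homologyFunctor D (j - 1)).mapIso e₃)
    · have : Injective S.X₂ := inferInstanceAs (Injective (Injective.under M))
      exact (isZero_homology_rightDerivedFunctorPlus_of_injective F S.X₂ j (by lia)).of_iso
        ((homologyFunctor D j).mapIso e₂)

omit [HasDerivedCategory C] [EnoughInjectives C] in
/-- A bound on all projective dimensions bounds all injective dimensions: both say that `Ext`
vanishes. -/
lemma hasInjectiveDimensionLT_of_forall_hasProjectiveDimensionLT (n : ℕ)
    (h : ∀ M : C, HasProjectiveDimensionLT M n) (M : C) : HasInjectiveDimensionLT M n := by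
  let _ := HasExt.standard C
  rw [hasInjectiveDimensionLT_iff]
  intro i hi Y e
  exact e.eq_zero_of_hasProjectiveDimensionLT n hi

end Vanishing

/-! ### Objects whose iterates under the inverse Serre functor are modules -/

section NuInvStable

attribute [local instance] HasDerivedCategory.standard

open DerivedCategory.Plus

variable (k A : Type u) [Field k] [Ring A] [Algebra k A]

/-- All the iterates of `ν_n⁻¹` send the object `X` to `mod A`. -/
def NuInvStable (n : ℕ) (X : DerivedCategory.Plus (ModuleCat.{u} Aᵐᵒᵖ)) : Prop :=
  ∀ i : ℕ, InModCat A ((nuInv k A n).obj^[i] X)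

variable {k A} {n : ℕ}

lemma NuInvStable.of_iso {X Y : DerivedCategory.Plus (ModuleCat.{u} Aᵐᵒᵖ)}
    (h : NuInvStable k A n X) (e : X ≅ Y) : NuInvStable k A n Y := fun i =>
  (h i).of_iso (nuInv_iterate_iso k A n i e).some

lemma NuInvStable.of_retract {X Y : DerivedCategory.Plus (ModuleCat.{u} Aᵐᵒᵖ)}
    (h : NuInvStable k A n X) (r : Retract Y X) : NuInvStable k A n Y := fun i =>
  (h i).of_retract (nuInv_iterate_retract k A n i r).some

lemma NuInvStable.nuInv_obj {X : DerivedCategory.Plus (ModuleCat.{u} Aᵐᵒᵖ)}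
    (h : NuInvStable k A n X) : NuInvStable k A n ((nuInv k A n).obj X) := fun i =>
  h (i + 1)

lemma NuInvStable.of_distTriang₂ [IsNoetherianRing Aᵐᵒᵖ]
    {T : Triangle (DerivedCategory.Plus (ModuleCat.{u} Aᵐᵒᵖ))} (hT : T ∈ distTriang _)
    (h₁ : NuInvStable k A n T.obj₁) (h₃ : NuInvStable k A n T.obj₃) :
    NuInvStable k A n T.obj₂ := fun i => by
  obtain ⟨T', hT', ⟨e₁⟩, ⟨e₂⟩, ⟨e₃⟩⟩ := exists_distTriang_nuInv_iterate k A n i T hT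
  exact (InModCat.of_distTriang₂ hT' ((h₁ i).of_iso e₁.symm) ((h₃ i).of_iso e₃.symm)).of_iso e₂

/-- If `gl.dim A ≤ n`, then `RHom(DA, M)` has no cohomology above degree `n`. -/
lemma isZero_homology_nuInv_of_pos (hgl : ∀ M : ModuleCat.{u} Aᵐᵒᵖ, HasProjectiveDimensionLE M n)
    {X : DerivedCategory.Plus (ModuleCat.{u} Aᵐᵒᵖ)} (hX : InModCat A X) (j : ℤ) (hj : 0 < j) :
    IsZero ((homologyFunctor (ModuleCat.{u} Aᵐᵒᵖ) j).obj ((nuInv k A n).obj X)) := by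
  obtain ⟨M, -, ⟨e⟩⟩ := hX
  have := hasInjectiveDimensionLT_of_forall_hasProjectiveDimensionLT (n + 1) hgl M
  refine (isZero_homology_rightDerivedFunctorPlus_of_hasInjectiveDimensionLT
    (homKDualFunctor k A) n M (n + j) (by lia)).of_iso ?_
  exact (homologyFunctor _ j).mapIso ((nuInv k A n).mapIso e) ≪≫ homologyNuInvIso k A n j _ rfl _

/-- Stability passes to the first term of a triangle: inductively, the `i`-th iterate of `X₁` lies
in `mod A`, so the next one has no cohomology in positive degrees, whereas the triangle confines its
cohomology to degrees `0` and `1`. -/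
lemma NuInvStable.of_distTriang₁ [IsNoetherianRing Aᵐᵒᵖ]
    (hgl : ∀ M : ModuleCat.{u} Aᵐᵒᵖ, HasProjectiveDimensionLE M n)
    {T : Triangle (DerivedCategory.Plus (ModuleCat.{u} Aᵐᵒᵖ))} (hT : T ∈ distTriang _)
    (h₁ : InModCat A T.obj₁) (h₂ : NuInvStable k A n T.obj₂) (h₃ : NuInvStable k A n T.obj₃) :
    NuInvStable k A n T.obj₁ := fun i => by
  induction i with
  | zero => exact h₁
  | succ i ih =>
    obtain ⟨T', hT', ⟨e₁⟩, ⟨e₂⟩, ⟨e₃⟩⟩ := exists_distTriang_nuInv_iterate k A n (i + 1) T hT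
    refine (InModCat.of_distTriang₁ hT' ((h₂ _).of_iso e₂.symm) ((h₃ _).of_iso e₃.symm)
      ?_).of_iso e₁
    refine IsZero.of_iso ?_ ((homologyFunctor _ 1).mapIso e₁)
    rw [Function.iterate_succ_apply']
    exact isZero_homology_nuInv_of_pos hgl ih 1 one_pos

/-- A ring, as a right module over itself, is the free module of rank one. -/
def opSelfEquiv (A : Type u) [Ring A] : A ≃ₗ[Aᵐᵒᵖ] Aᵐᵒᵖ where
  toFun := op
  invFun := unop
  map_add' _ _ := rfl
  map_smul' _ _ := rfl
  left_inv _ := rfl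
  right_inv _ := rfl

lemma NuInvStable.single_pi [IsNoetherianRing Aᵐᵒᵖ]
    (h : NuInvStable k A n ((singleFunctor _ 0).obj (ModuleCat.of Aᵐᵒᵖ A))) (m : ℕ) :
    NuInvStable k A n ((singleFunctor _ 0).obj (ModuleCat.of Aᵐᵒᵖ (Fin m → A))) := by
  induction m with
  | zero =>
    refine h.of_retract (Retract.map (C := ModuleCat.{u} Aᵐᵒᵖ) ?_ (singleFunctor _ 0))
    exact { i := 0, r := 0, retract := ModuleCat.hom_ext (LinearMap.ext fun (_ : Fin 0 → A) =>
              Subsingleton.elim (α := Fin 0 → A) _ _) }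
  | succ m ih =>
    let f : A →ₗ[Aᵐᵒᵖ] (Fin (m + 1) → A) := LinearMap.single Aᵐᵒᵖ (fun _ => A) 0
    let g : (Fin (m + 1) → A) →ₗ[Aᵐᵒᵖ] (Fin m → A) := LinearMap.funLeft Aᵐᵒᵖ A Fin.succ
    let S : ShortComplex (ModuleCat.{u} Aᵐᵒᵖ) := ShortComplex.mk (ModuleCat.ofHom f)
      (ModuleCat.ofHom g) (by
        refine ModuleCat.hom_ext (LinearMap.ext fun x => funext fun i => ?_)
        exact Pi.single_eq_of_ne (M := fun _ : Fin (m + 1) => A) (Fin.succ_ne_zero i) x)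
    have hS : S.ShortExact := by
      have : Mono S.f := (ModuleCat.mono_iff_injective _).2
        (Pi.single_injective (M := fun _ : Fin (m + 1) => A) 0)
      have : Epi S.g := (ModuleCat.epi_iff_surjective _).2
        (LinearMap.funLeft_surjective_of_injective _ _ _ (Fin.succ_injective m))
      refine ⟨(ShortComplex.moduleCat_exact_iff _).2 fun x hx => ⟨x 0, ?_⟩⟩
      funext i
      refine Fin.cases ?_ (fun i => ?_) i
      · exact Pi.single_eq_same (M := fun _ : Fin (m + 1) => A) 0 (x 0)
      · exact (Pi.single_eq_of_ne (M := fun _ : Fin (m + 1) => A) (Fin.succ_ne_zero i)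
          (x 0)).trans (congrFun hx i).symm
    obtain ⟨T, hT, h₁, h₂, h₃⟩ := exists_distTriang_single hS
    exact h₂ ▸ NuInvStable.of_distTriang₂ hT (h₁ ▸ h) (h₃ ▸ ih)

lemma NuInvStable.single_of_projective [IsNoetherianRing Aᵐᵒᵖ]
    (h : NuInvStable k A n ((singleFunctor _ 0).obj (ModuleCat.of Aᵐᵒᵖ A)))
    (P : ModuleCat.{u} Aᵐᵒᵖ) [Module.Finite Aᵐᵒᵖ P] [Module.Projective Aᵐᵒᵖ P] :
    NuInvStable k A n ((singleFunctor _ 0).obj P) := by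
  obtain ⟨m, f, hf⟩ := Module.Finite.exists_fin' Aᵐᵒᵖ P
  let f' : (Fin m → A) →ₗ[Aᵐᵒᵖ] P :=
    f ∘ₗ (LinearEquiv.piCongrRight fun _ => opSelfEquiv A).toLinearMap
  obtain ⟨s, hs⟩ := Module.projective_lifting_property f' LinearMap.id
    (hf.comp (LinearEquiv.surjective _))
  refine (h.single_pi m).of_retract (Retract.map (C := ModuleCat.{u} Aᵐᵒᵖ) ?_ (singleFunctor _ 0))
  exact { i := ModuleCat.ofHom s, r := ModuleCat.ofHom f', retract := by
            ext x; exact LinearMap.congr_fun hs x }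

end NuInvStable

/-! ### The cogenerator `DA` -/

namespace KDual

section

variable {k A : Type u} [Field k] [Ring A] [Algebra k A]

/-- An element of `DA`, as a linear form on `A`. -/
def toLin (f : KDual k A) : A →ₗ[k] k := f

lemma toLin_injective : Function.Injective (toLin : KDual k A → (A →ₗ[k] k)) := fun _ _ h => h

lemma toLin_op_smul (a x : A) (f : KDual k A) : (op a • f).toLin x = f.toLin (a * x) := rfl

lemma toLin_op_algebraMap_smul (c : k) (x : A) (f : KDual k A) :
    (op (algebraMap k A c) • f).toLin x = c * f.toLin x := by
  rw [toLin_op_smul, ← Algebra.smul_def, map_smul, smul_eq_mul]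

lemma toLin_sum {σ : Type*} (s : Finset σ) (f : σ → KDual k A) (x : A) :
    (∑ i ∈ s, f i).toLin x = ∑ i ∈ s, (f i).toLin x := by
  let g : KDual k A →+ k :=
    { toFun := fun f => f.toLin x, map_zero' := rfl, map_add' := fun _ _ => rfl }
  exact map_sum g f s

lemma ext_toLin {f g : KDual k A} (h : ∀ x, f.toLin x = g.toLin x) : f = g :=
  toLin_injective (LinearMap.ext h)

end

section Embedding

variable (k A : Type u) [Field k] [Ring A] [Algebra k A] [Module.Finite k A]

/-- The module `DA` is a cogenerator: every right module embeds in a direct sum of copies of `DA`.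
A direct sum suffices because `A` is finite dimensional. -/
lemma exists_injective_finsupp (M : Type u) [AddCommGroup M] [Module Aᵐᵒᵖ M] :
    ∃ (ι : Type u) (φ : M →ₗ[Aᵐᵒᵖ] (ι →₀ KDual k A)), Function.Injective φ := by
  let : Module k M := Module.compHom M (algebraMap k Aᵐᵒᵖ)
  have hk : ∀ (c : k) (m : M), c • m = op (algebraMap k A c) • m := fun _ _ => rfl
  let b := Module.Basis.ofVectorSpace k M
  let act : M → A →ₗ[k] M := fun m =>
    { toFun := fun x => op x • m
      map_add' := fun x y => by rw [MulOpposite.op_add, add_smul]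
      map_smul' := fun c x => by
        rw [RingHom.id_apply, hk, ← mul_smul, ← MulOpposite.op_mul, Algebra.smul_def,
          Algebra.commutes] }
  let F : M → Module.Basis.ofVectorSpaceIndex k M → KDual k A := fun m i =>
    (b.coord i ∘ₗ act m : A →ₗ[k] k)
  -- the components of the embedding are `m ↦ (x ↦ b_i (m x))`
  have hF : ∀ m i x, (F m i).toLin x = b.repr (op x • m) i := fun _ _ _ => rfl
  let β := Module.finBasis k A
  have hfin : ∀ m, (Function.support (F m)).Finite := by
    intro m
    refine Set.Finite.subset
      (Set.finite_iUnion fun s => (b.repr (op (β s) • m)).hasFiniteSupport) ?_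
    intro i hi
    by_contra hn
    refine hi (ext_toLin fun x => ?_)
    have : (F m i).toLin = 0 := β.ext fun s => by
      have hn' := fun h => hn (Set.mem_iUnion.2 ⟨s, h⟩)
      rw [hF]
      simpa using hn'
    rw [this]
    rfl
  refine ⟨_, LinearMap.mk (AddHom.mk (fun m => Finsupp.ofSupportFinite (F m) (hfin m)) ?_) ?_, ?_⟩
  · intro m m'
    ext i
    refine ext_toLin fun x => ?_
    change (F _ i).toLin x = (F m i).toLin x + (F m' i).toLin x
    simp [hF, smul_add]
  · intro a m
    ext i
    refine ext_toLin fun x => ?_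
    change (F (a • m) i).toLin x = (F m i).toLin (a.unop * x)
    rw [hF, hF, MulOpposite.op_mul, mul_smul, op_unop]
  · intro m m' h
    refine b.repr.injective (Finsupp.ext fun i => ?_)
    have := congrArg (fun t => (t i).toLin 1) h
    change (F m i).toLin 1 = (F m' i).toLin 1 at this
    simpa [hF] using this

end Embedding

end KDual

namespace HomKDual

section

variable {k A : Type u} [Field k] [Ring A] [Algebra k A] {X : Type u} [AddCommGroup X]
  [Module Aᵐᵒᵖ X]

/-- An element of `Hom_A(DA, X)`, as a linear map. -/
def toHom (φ : HomKDual k A X) : KDual k A →ₗ[Aᵐᵒᵖ] X := φ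

/-- A linear map `DA → X`, as an element of `Hom_A(DA, X)`. -/
def ofHom (φ : KDual k A →ₗ[Aᵐᵒᵖ] X) : HomKDual k A X := φ

lemma ext_toHom {φ ψ : HomKDual k A X} (h : ∀ f, φ.toHom f = ψ.toHom f) : φ = ψ :=
  LinearMap.ext (M := KDual k A) h

end

section

variable (k A : Type u) [Field k] [Ring A] [Algebra k A]

/-- The map `A^(ι) → Hom_A(DA, (DA)^(ι))` induced by the left action of `A` on `DA`. -/
noncomputable def finsuppMap (ι : Type u) :
    (ι →₀ A) →ₗ[Aᵐᵒᵖ] HomKDual k A (ι →₀ KDual k A) where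
  toFun a := ofHom
    { toFun := fun f => a.mapRange (fun a => a • f) (zero_smul A f)
      map_add' := fun f g => Finsupp.ext fun i => smul_add (a i) f g
      map_smul' := fun b f => Finsupp.ext fun i => smul_comm (a i) b f }
  map_add' a b := ext_toHom fun f => Finsupp.ext fun i => add_smul (a i) (b i) f
  map_smul' b a := ext_toHom fun f => Finsupp.ext fun i => mul_smul (a i) b.unop f

variable {k A}

lemma toLin_finsuppMap {ι : Type u} (a : ι →₀ A) (f : KDual k A) (i : ι) (x : A) :
    ((finsuppMap k A ι a).toHom f i).toLin x = f.toLin (x * a i) := rfl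

/-- `End(DA) = A`, and `Hom(DA, -)` commutes with direct sums since `DA` is finite dimensional. -/
lemma finsuppMap_bijective [Module.Finite k A] (ι : Type u) :
    Function.Bijective (finsuppMap k A ι) := by
  let β := Module.finBasis k A
  constructor
  · rw [injective_iff_map_eq_zero]
    intro a ha
    ext i
    refine (Module.forall_dual_apply_eq_zero_iff k (a i)).1 fun f => ?_
    have := toLin_finsuppMap a (show KDual k A from f) i 1
    rw [ha, one_mul] at this
    exact this.symm
  · intro φ
    let d : Fin (Module.finrank k A) → KDual k A := fun s => (β.coord s : A →ₗ[k] k)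
    have hd : ∀ s x, (d s).toLin x = β.repr x s := fun _ _ => rfl
    -- `φ f i` is determined by its value at `1`, since `φ` is linear over `A`
    let c : ι → A := fun i => ∑ s, (φ.toHom (d s) i).toLin 1 • β s
    have hc : (Function.support c).Finite := by
      refine Set.Finite.subset (Set.finite_iUnion fun s => (φ.toHom (d s)).hasFiniteSupport) ?_
      intro i hi
      by_contra hn
      refine hi (Finset.sum_eq_zero fun s _ => ?_)
      have hn' : φ.toHom (d s) i = 0 := by
        have := fun h => hn (Set.mem_iUnion.2 ⟨s, h⟩)
        simpa using this
      rw [hn']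
      exact zero_smul k _
    have key : ∀ (f : KDual k A) (i : ι), f.toLin (c i) = (φ.toHom f i).toLin 1 := by
      intro f i
      have hf : f = ∑ s, op (algebraMap k A (f.toLin (β s))) • d s := KDual.ext_toLin fun x => by
        rw [KDual.toLin_sum]
        simp only [KDual.toLin_op_algebraMap_smul, hd]
        calc f.toLin x = f.toLin (∑ s, β.repr x s • β s) := by rw [β.sum_repr]
          _ = _ := by simp only [map_sum, map_smul, smul_eq_mul, mul_comm]
      conv_rhs => rw [hf]
      simp only [map_sum, map_smul, Finsupp.finsetSum_apply, Finsupp.smul_apply,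
        KDual.toLin_sum, KDual.toLin_op_algebraMap_smul, c, smul_eq_mul, mul_comm]
    refine ⟨Finsupp.ofSupportFinite c hc, ext_toHom fun f => Finsupp.ext fun i =>
      KDual.ext_toLin fun x => ?_⟩
    rw [toLin_finsuppMap]
    change f.toLin (x * c i) = _
    rw [← KDual.toLin_op_smul, key, map_smul]
    change (φ.toHom f i).toLin (x * 1) = _
    rw [mul_one]

/-- The functor `Hom(DA, -)` sends injectives, which are summands of sums of copies of `DA`, to
summands of free modules. -/
lemma projective_of_injective [Module.Finite k A] (I : ModuleCat.{u} Aᵐᵒᵖ) [Injective I] :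
    Projective ((homKDualFunctor k A).obj I) := by
  obtain ⟨ι, φ, hφ⟩ := KDual.exists_injective_finsupp k A I
  have : Mono (ModuleCat.ofHom φ) := (ModuleCat.mono_iff_injective _).2 hφ
  let r : Retract I (ModuleCat.of Aᵐᵒᵖ (ι →₀ KDual k A)) :=
    { i := ModuleCat.ofHom φ
      r := Injective.factorThru (𝟙 I) (ModuleCat.ofHom φ)
      retract := Injective.comp_factorThru _ _ }
  have h1 : Module.Projective Aᵐᵒᵖ (ι →₀ A) :=
    Module.Projective.of_equiv (Finsupp.mapRange.linearEquiv (opSelfEquiv A).symm)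
  have h2 : Projective ((homKDualFunctor k A).obj (ModuleCat.of Aᵐᵒᵖ (ι →₀ KDual k A))) := by
    rw [← IsProjective.iff_projective]
    exact Module.Projective.of_equiv (LinearEquiv.ofBijective _ (finsuppMap_bijective (k := k) ι))
  exact (r.map (homKDualFunctor k A)).projective

end

end HomKDual

/-! ### The submodule `N e A` for an idempotent `e` with `(1 - e) A e = 0` -/

section SplitHomology

/-- If both differentials of a short complex are von Neumann regular, its homology is a direct
summand of the middle object. -/
lemma ShortComplex.nonempty_retract_homology {C : Type*} [Category* C] [Abelian C]
    (S : ShortComplex C) (s : S.X₂ ⟶ S.X₁) (t : S.X₃ ⟶ S.X₂) (hs : S.f ≫ s ≫ S.f = S.f)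
    (ht : S.g ≫ t ≫ S.g = S.g) : Nonempty (Retract S.homology S.X₂) := by
  let p : S.X₂ ⟶ S.X₂ := 𝟙 _ - S.g ≫ t
  let q : S.X₂ ⟶ S.X₂ := 𝟙 _ - s ≫ S.f
  have hp : p ≫ S.g = 0 := by simp [p, ht]
  have hq : S.f ≫ q = 0 := by simp [q, hs]
  have hip : S.iCycles ≫ p = S.iCycles := by simp [p]
  have hqg : (q ≫ p) ≫ S.g = 0 := by simp [hp]
  refine ⟨{ i := S.descHomology (S.iCycles ≫ q) (by simp [hq])
            r := S.liftCycles p hp ≫ S.homologyπ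
            retract := ?_ }⟩
  rw [← cancel_epi S.homologyπ]
  have h1 : S.iCycles ≫ q ≫ S.liftCycles p hp = 𝟙 _ - (S.iCycles ≫ s) ≫ S.toCycles := by
    rw [← cancel_mono S.iCycles]
    simp [q, p]
  simp only [ShortComplex.π_descHomology_assoc, Category.assoc, Category.comp_id]
  have h2 := congrArg (fun t => t ≫ S.homologyπ) h1
  simpa using h2

end SplitHomology

section Semisimple

variable {R : Type*} [Ring R] {V W : Type*} [AddCommGroup V] [AddCommGroup W] [Module R V]
  [Module R W]

/-- Linear maps between semisimple modules are von Neumann regular. -/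
lemma LinearMap.exists_comp_comp_eq_self [IsSemisimpleModule R V] [IsSemisimpleModule R W]
    (g : V →ₗ[R] W) : ∃ s : W →ₗ[R] V, g ∘ₗ s ∘ₗ g = g := by
  obtain ⟨t, ht⟩ := IsSemisimpleModule.lifting_property g.rangeRestrict g.surjective_rangeRestrict
    LinearMap.id
  obtain ⟨s, hs⟩ := IsSemisimpleModule.extension_property g.range.subtype
    g.range.injective_subtype t
  refine ⟨s, LinearMap.ext fun v => ?_⟩
  have h1 := LinearMap.congr_fun hs (g.rangeRestrict v)
  have h2 := congrArg Subtype.val (LinearMap.congr_fun ht (g.rangeRestrict v))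
  change s (g v) = _ at h1
  change g (t _) = g v at h2
  change g (s (g v)) = g v
  rw [h1, h2]

end Semisimple

section Idempotent

variable {A : Type u} [Ring A] {e : A}

/-- The condition `(1 - e) A e = 0` in the form `e a e = a e`. -/
lemma mul_idem_eq (h_str : ∀ a : A, (1 - e) * a * e = 0) (a : A) : e * a * e = a * e := by
  have := h_str a
  rw [sub_mul, sub_mul, one_mul, sub_eq_zero] at this
  exact this.symm

/-- A right module on which `e` acts as the identity is a module over `eAe`, hence semisimple
when `eAe` is. -/
lemma isSemisimpleModule_of_op_smul_eq (he : IsIdempotentElem e)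
    (h_str : ∀ a : A, (1 - e) * a * e = 0) (h_ss : IsSemisimpleRing he.Corner)
    (V : Type*) [AddCommGroup V] [Module Aᵐᵒᵖ V] (hV : ∀ v : V, op e • v = v) :
    IsSemisimpleModule Aᵐᵒᵖ V := by
  let c : A → he.Corner := fun a => ⟨e * a * e, a, rfl⟩
  let σ : Aᵐᵒᵖ →+* he.Cornerᵐᵒᵖ :=
    { toFun := fun a => op (c a.unop)
      map_one' := congrArg op (Subtype.ext (by simp [c, he.eq]; rfl))
      map_mul' := fun a b => congrArg op (Subtype.ext (by
        change e * (b.unop * a.unop) * e = e * b.unop * e * (e * a.unop * e)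
        rw [mul_idem_eq h_str a.unop, mul_assoc (e * b.unop), ← mul_assoc e a.unop,
          mul_idem_eq h_str a.unop]
        simp only [mul_assoc]))
      map_zero' := congrArg op (Subtype.ext (by simp [c]; rfl))
      map_add' := fun a b => congrArg op (Subtype.ext (by
        change e * (a.unop + b.unop) * e = e * a.unop * e + e * b.unop * e
        simp only [mul_add, add_mul])) }
  have hσ : Function.Surjective σ := fun s => by
    obtain ⟨⟨s, a, rfl⟩⟩ := s
    exact ⟨op a, rfl⟩
  let : Module he.Cornerᵐᵒᵖ V :=
    { smul := fun s v => op s.unop.val • v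
      one_smul := hV
      mul_smul := fun s t v => mul_smul (op s.unop.val) (op t.unop.val) v
      smul_zero := fun s => smul_zero (op s.unop.val)
      smul_add := fun s => smul_add (op s.unop.val)
      add_smul := fun s t v => add_smul (op s.unop.val) (op t.unop.val) v
      zero_smul := fun v => zero_smul Aᵐᵒᵖ v }
  have : RingHomSurjective σ := ⟨hσ⟩
  let l : V →ₛₗ[σ] V :=
    { toFun := id
      map_add' := fun _ _ => rfl
      map_smul' := fun a v => by
        change a • v = op (e * a.unop * e) • v
        rw [MulOpposite.op_mul, MulOpposite.op_mul, mul_smul, mul_smul, hV v, hV, op_unop] }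
  exact (LinearMap.isSemisimpleModule_iff_of_bijective l Function.bijective_id).2 inferInstance

variable (e) in
/-- The trace `N e A` of the idempotent `e` in a right module `N`. -/
def idemTrace (N : Type*) [AddCommGroup N] [Module Aᵐᵒᵖ N] : Submodule Aᵐᵒᵖ N :=
  Submodule.span Aᵐᵒᵖ (Set.range fun n : N => op e • n)

lemma op_smul_mem_idemTrace {N : Type*} [AddCommGroup N] [Module Aᵐᵒᵖ N] (n : N) :
    op e • n ∈ idemTrace e N := Submodule.subset_span ⟨n, rfl⟩

lemma map_mem_idemTrace {N N' : Type*} [AddCommGroup N] [Module Aᵐᵒᵖ N] [AddCommGroup N']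
    [Module Aᵐᵒᵖ N'] (f : N →ₗ[Aᵐᵒᵖ] N') (n : N) (hn : n ∈ idemTrace e N) :
    f n ∈ idemTrace e N' := by
  refine (Submodule.span_le (p := (idemTrace e N').comap f)).2 ?_ hn
  rintro - ⟨x, rfl⟩
  simp only [SetLike.mem_coe, Submodule.mem_comap, map_smul]
  exact op_smul_mem_idemTrace _

/-- Linear maps that agree on `N e` agree on `N e A`. -/
lemma eq_of_mem_idemTrace {N N' : Type*} [AddCommGroup N] [Module Aᵐᵒᵖ N] [AddCommGroup N']
    [Module Aᵐᵒᵖ N'] {f g : N →ₗ[Aᵐᵒᵖ] N'} (h : ∀ n, op e • f n = op e • g n) (n : N)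
    (hn : n ∈ idemTrace e N) : f n = g n := by
  refine LinearMap.eqOn_span (f := f) (g := g) ?_ hn
  rintro - ⟨x, rfl⟩
  simp only [map_smul, h]

variable (e) in
/-- The functor `N ↦ N e A`. -/
def idemTraceFunctor : ModuleCat.{u} Aᵐᵒᵖ ⥤ ModuleCat.{u} Aᵐᵒᵖ where
  obj N := ModuleCat.of Aᵐᵒᵖ (idemTrace e N)
  map f := ModuleCat.ofHom (f.hom.restrict (map_mem_idemTrace f.hom))
  map_id _ := rfl
  map_comp _ _ := rfl

instance : (idemTraceFunctor e).Additive where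
  map_add := rfl

variable (e) in
/-- The inclusion `N e A ⊆ N`. -/
def idemTraceι : idemTraceFunctor e ⟶ 𝟭 (ModuleCat.{u} Aᵐᵒᵖ) where
  app N := ModuleCat.ofHom (idemTrace e N).subtype
  naturality _ _ _ := rfl

lemma idemTraceFunctor_map_eq {N N' : ModuleCat.{u} Aᵐᵒᵖ} {f g : N ⟶ N'}
    (h : ∀ n, op e • f.hom n = op e • g.hom n) :
    (idemTraceFunctor e).map f = (idemTraceFunctor e).map g :=
  ModuleCat.hom_ext (LinearMap.ext fun n => Subtype.ext (eq_of_mem_idemTrace h n.1 n.2))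

lemma idemTrace_idemTrace (he : IsIdempotentElem e) (N : Type*) [AddCommGroup N]
    [Module Aᵐᵒᵖ N] : idemTrace e (idemTrace e N) = ⊤ := by
  rw [eq_top_iff]
  have : idemTrace e N ≤ (idemTrace e (idemTrace e N)).map (idemTrace e N).subtype := by
    refine Submodule.span_le.2 ?_
    rintro - ⟨x, rfl⟩
    refine ⟨op e • ⟨op e • x, op_smul_mem_idemTrace x⟩, op_smul_mem_idemTrace _, ?_⟩
    change op e • op e • x = op e • x
    rw [← mul_smul, ← MulOpposite.op_mul, he.eq]
  rintro ⟨n, hn⟩ -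
  obtain ⟨m, hm, rfl⟩ := this hn
  exact hm

/-- The submodule `{n | n e = 0}` of a right module. -/
def idemAnn (h_str : ∀ a : A, (1 - e) * a * e = 0) (N : Type*) [AddCommGroup N]
    [Module Aᵐᵒᵖ N] : Submodule Aᵐᵒᵖ N where
  carrier := {n | op e • n = 0}
  add_mem' {a b} ha hb := by
    change op e • (a + b) = 0
    rw [smul_add, show op e • a = 0 from ha, show op e • b = 0 from hb, add_zero]
  zero_mem' := smul_zero _
  smul_mem' a n hn := by
    change op e • a • n = 0
    rw [← mul_smul, ← op_unop a, ← MulOpposite.op_mul, ← mul_idem_eq h_str,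
      MulOpposite.op_mul, MulOpposite.op_mul, mul_smul, mul_smul,
      show op e • n = 0 from hn, smul_zero, smul_zero]

lemma isSemisimpleModule_quotient_idemAnn (he : IsIdempotentElem e)
    (h_str : ∀ a : A, (1 - e) * a * e = 0) (h_ss : IsSemisimpleRing he.Corner)
    (N : Type*) [AddCommGroup N] [Module Aᵐᵒᵖ N] :
    IsSemisimpleModule Aᵐᵒᵖ (N ⧸ idemAnn h_str N) := by
  refine isSemisimpleModule_of_op_smul_eq he h_str h_ss _ fun v => ?_
  obtain ⟨n, rfl⟩ := Submodule.Quotient.mk_surjective _ v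
  rw [← Submodule.Quotient.mk_smul, Submodule.Quotient.eq]
  change op e • (op e • n - n) = 0
  rw [smul_sub, ← mul_smul, ← MulOpposite.op_mul, he.eq, sub_self]

/-- The restriction of `f` to the submodules `N e A → N' e A` is von Neumann regular. On `N e` and
`N' e`, which are the quotients of `N` and `N'` by the elements killed by `e`, this holds by
semisimplicity of `eAe`; the quasi-inverse lifts to `N'` by projectivity, and the identity needs to
be checked on `N e` only. -/
lemma exists_idemTraceFunctor_map_comp_comp (he : IsIdempotentElem e)
    (h_str : ∀ a : A, (1 - e) * a * e = 0) (h_ss : IsSemisimpleRing he.Corner)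
    {N N' : ModuleCat.{u} Aᵐᵒᵖ} [Projective N'] (f : N ⟶ N') :
    ∃ s : (idemTraceFunctor e).obj N' ⟶ (idemTraceFunctor e).obj N,
      (idemTraceFunctor e).map f ≫ s ≫ (idemTraceFunctor e).map f =
        (idemTraceFunctor e).map f := by
  have h1 := isSemisimpleModule_quotient_idemAnn he h_str h_ss N
  have h2 := isSemisimpleModule_quotient_idemAnn he h_str h_ss N'
  have hf : idemAnn h_str N ≤ (idemAnn h_str N').comap f.hom := fun n hn => by
    change op e • f.hom n = 0
    rw [← map_smul, show op e • n = 0 from hn, map_zero]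
  obtain ⟨s, hs⟩ := ((idemAnn h_str N).mapQ _ f.hom hf).exists_comp_comp_eq_self
  have hN' : Module.Projective Aᵐᵒᵖ N' := (IsProjective.iff_projective (R := Aᵐᵒᵖ) N').2 ‹_›
  obtain ⟨t, ht⟩ := Module.projective_lifting_property (idemAnn h_str N).mkQ
    (s ∘ₗ (idemAnn h_str N').mkQ) (Submodule.mkQ_surjective _)
  refine ⟨(idemTraceFunctor e).map (ModuleCat.ofHom t), ?_⟩
  rw [← Functor.map_comp, ← Functor.map_comp]
  refine idemTraceFunctor_map_eq fun n => ?_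
  have h3 := LinearMap.congr_fun hs ((idemAnn h_str N).mkQ n)
  have h4 := LinearMap.congr_fun ht (f.hom n)
  simp only [LinearMap.comp_apply, Submodule.mkQ_apply, Submodule.mapQ_apply] at h3 h4
  rw [← h4, Submodule.mapQ_apply, Submodule.Quotient.eq] at h3
  have h5 : op e • (f.hom (t (f.hom n)) - f.hom n) = 0 := h3
  rw [smul_sub, sub_eq_zero] at h5
  exact h5

/-- If `N` is projective, so is `N e A`: for `N = A` this is `A e A = e A`, and left multiplication
by `e` is a retraction of the free module onto it, which descends to summands. -/
lemma projective_idemTraceFunctor_obj (h_str : ∀ a : A, (1 - e) * a * e = 0)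
    (N : ModuleCat.{u} Aᵐᵒᵖ) [Projective N] : Projective ((idemTraceFunctor e).obj N) := by
  have hN : Module.Projective Aᵐᵒᵖ N := (IsProjective.iff_projective (R := Aᵐᵒᵖ) N).2 ‹_›
  obtain ⟨i, hi⟩ := Module.projective_def.1 hN
  rw [← IsProjective.iff_projective]
  -- left multiplication by `e` on the free module, followed by the projection onto `N`
  let E : (N →₀ Aᵐᵒᵖ) →ₗ[Aᵐᵒᵖ] (N →₀ Aᵐᵒᵖ) :=
    Finsupp.mapRange.linearMap (LinearMap.toSpanSingleton Aᵐᵒᵖ Aᵐᵒᵖ (op e))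
  have hE : ∀ x y, E x y = x y * op e := fun x y => by simp [E]
  let φ := Finsupp.linearCombination Aᵐᵒᵖ (id : N → N)
  have hφ : ∀ x, φ (E x) ∈ idemTrace e N := fun x => by
    rw [Finsupp.linearCombination_apply]
    refine Submodule.sum_mem _ fun y _ => ?_
    change (E x) y • y ∈ _
    rw [hE, mul_smul]
    exact Submodule.smul_mem _ _ (op_smul_mem_idemTrace _)
  refine Module.Projective.of_split (i ∘ₗ (idemTrace e N).subtype)
    ((φ ∘ₗ E).codRestrict (idemTrace e N) hφ) ?_
  refine LinearMap.ext fun (n : idemTrace e N) => Subtype.ext ?_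
  refine LinearMap.eqOn_span (f := φ ∘ₗ E ∘ₗ i) (g := LinearMap.id) ?_ n.2
  rintro - ⟨x, rfl⟩
  have hEi : E (i (op e • x)) = i (op e • x) := Finsupp.ext fun y => by
    rw [hE, map_smul, Finsupp.smul_apply, smul_eq_mul]
    refine unop_injective ?_
    change e * ((i x y).unop * e) = (i x y).unop * e
    rw [← mul_assoc, mul_idem_eq h_str]
  change φ (E (i (op e • x))) = op e • x
  rw [hEi]
  exact hi _

end Idempotent

/-! ### Restriction and coextension of scalars -/

section ChangeOfRings

variable {R S : Type u} [Ring R] [Ring S] (f : R →+* S)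

lemma ShortExact.map_restrictScalars {T : ShortComplex (ModuleCat.{u} S)} (hT : T.ShortExact) :
    (T.map (ModuleCat.restrictScalars.{u} f)).ShortExact := by
  have h := (ShortComplex.ShortExact.moduleCat_exact_iff_function_exact T).1 hT.exact
  have hm : Mono (T.map (ModuleCat.restrictScalars.{u} f)).f :=
    (ModuleCat.mono_iff_injective _).2 hT.moduleCat_injective_f
  have he : Epi (T.map (ModuleCat.restrictScalars.{u} f)).g :=
    (ModuleCat.epi_iff_surjective _).2 hT.moduleCat_surjective_g
  exact ⟨(ShortComplex.ShortExact.moduleCat_exact_iff_function_exact _).2 h⟩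

instance : PreservesFiniteLimits (ModuleCat.restrictScalars.{u} f) := by
  have h : PreservesFiniteLimits (ModuleCat.restrictScalars.{u} f) ∧
      PreservesFiniteColimits (ModuleCat.restrictScalars.{u} f) :=
    ((ModuleCat.restrictScalars.{u} f).exact_tfae.out 0 3).1
      fun _ hT => ShortExact.map_restrictScalars f hT
  exact h.1

/-- Modules over a quotient ring form a full subcategory. -/
lemma full_restrictScalars (hf : Function.Surjective f) :
    (ModuleCat.restrictScalars.{u} f).Full where
  map_surjective {M N} g := by
    refine ⟨ModuleCat.ofHom (LinearMap.mk (AddHom.mk g.hom fun x y => map_add g.hom x y) ?_), rfl⟩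
    intro s x
    obtain ⟨r, rfl⟩ := hf s
    exact g.hom.map_smul r x

/-- Coextension of scalars, right adjoint to restriction of scalars. -/
noncomputable def coext : ModuleCat.{u} R ⥤ ModuleCat.{u} S := ModuleCat.coextendScalars f

/-- The adjunction between restriction and coextension of scalars. -/
noncomputable def restrictCoextAdj : ModuleCat.restrictScalars.{u} f ⊣ coext f :=
  ModuleCat.restrictCoextendScalarsAdj f

instance : (coext f).Additive :=
  (restrictCoextAdj f).right_adjoint_additive

variable {f}

lemma coextendScalars_preservesEpimorphisms
    (hS : Projective ((ModuleCat.restrictScalars.{u} f).obj (ModuleCat.of S S))) :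
    (coext f).PreservesEpimorphisms where
  preserves {M N} g hg := by
    rw [ModuleCat.epi_iff_surjective]
    intro φ
    have : Module.Projective R ((ModuleCat.restrictScalars.{u} f).obj (ModuleCat.of S S)) :=
      (IsProjective.iff_projective (R := R) _).2 hS
    obtain ⟨ψ, hψ⟩ := Module.projective_lifting_property g.hom
      (ModuleCat.CoextendScalars.equiv f N φ) ((ModuleCat.epi_iff_surjective g).1 hg)
    refine ⟨(ModuleCat.CoextendScalars.equiv f M).symm ψ, ?_⟩
    exact (ModuleCat.CoextendScalars.equiv f N).injective hψ

lemma restrictScalars_projective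
    (hS : Projective ((ModuleCat.restrictScalars.{u} f).obj (ModuleCat.of S S)))
    (P : ModuleCat.{u} S) [Projective P] : Projective ((ModuleCat.restrictScalars.{u} f).obj P) :=
  have := coextendScalars_preservesEpimorphisms hS
  (restrictCoextAdj f).map_projective P ‹_›

lemma coextendScalars_injective (I : ModuleCat.{u} R) [Injective I] :
    Injective ((coext f).obj I) :=
  (restrictCoextAdj f).map_injective I ‹_›

lemma coextendScalars_exact
    (hS : Projective ((ModuleCat.restrictScalars.{u} f).obj (ModuleCat.of S S))) :
    PreservesFiniteLimits (coext f) ∧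
      PreservesFiniteColimits (coext f) := by
  have h := (coext f).exact_tfae.out 0 3
  refine h.1 fun T hT => ?_
  have hadj := restrictCoextAdj f
  have := coextendScalars_preservesEpimorphisms hS
  have hl : PreservesLimits (coext f) := hadj.rightAdjoint_preservesLimits
  have hl' : PreservesLimit (parallelPair T.g 0) (coext f) := inferInstance
  have := hT.mono_f
  have := hT.epi_g
  have h1 : Mono (T.map (coext f)).f :=
    inferInstanceAs (Mono ((coext f).map T.f))
  have h2 : Epi (T.map (coext f)).g :=
    inferInstanceAs (Epi ((coext f).map T.g))
  exact ⟨hT.exact.map_of_mono_of_preservesKernel _ inferInstance inferInstance⟩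

/-- If `f` is surjective and `S` is projective over `R`, the projective dimension of an `S`-module
is at most its projective dimension over `R`: a syzygy over `S` is one over `R`. -/
lemma hasProjectiveDimensionLT_of_restrictScalars (hf : Function.Surjective f)
    (hS : Projective ((ModuleCat.restrictScalars.{u} f).obj (ModuleCat.of S S)))
    (n : ℕ) (M : ModuleCat.{u} S)
    (hM : HasProjectiveDimensionLT ((ModuleCat.restrictScalars.{u} f).obj M) n) :
    HasProjectiveDimensionLT M n := by
  match n with
  | 0 =>
    rw [hasProjectiveDimensionLT_zero_iff_isZero] at hM ⊢
    rw [ModuleCat.isZero_iff_subsingleton] at hM ⊢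
    exact hM
  | 1 =>
    rw [← projective_iff_hasProjectiveDimensionLT_one] at hM ⊢
    have hT := M.shortExact_projectiveShortComplex
    have hT' := ShortExact.map_restrictScalars f hT
    have hepi : Epi ((ModuleCat.restrictScalars.{u} f).map M.projectiveShortComplex.g) := hT'.epi_g
    have := full_restrictScalars f hf
    let s : (ModuleCat.restrictScalars.{u} f).obj M ⟶
        (ModuleCat.restrictScalars.{u} f).obj M.projectiveShortComplex.X₂ :=
      Projective.factorThru (𝟙 _)
        ((ModuleCat.restrictScalars.{u} f).map M.projectiveShortComplex.g)
    have hs : s ≫ (ModuleCat.restrictScalars.{u} f).map M.projectiveShortComplex.g = 𝟙 _ :=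
      Projective.factorThru_comp _ _
    let r : Retract M M.projectiveShortComplex.X₂ :=
      { i := (ModuleCat.restrictScalars.{u} f).preimage s
        r := M.projectiveShortComplex.g
        retract := (ModuleCat.restrictScalars.{u} f).map_injective (by
          rw [Functor.map_comp, Functor.map_preimage, CategoryTheory.Functor.map_id]
          exact hs) }
    exact r.projective
  | n + 2 =>
    have hT := M.shortExact_projectiveShortComplex
    have hT' := ShortExact.map_restrictScalars f hT
    refine (hT.hasProjectiveDimensionLT_X₃_iff n inferInstance).2
      (hasProjectiveDimensionLT_of_restrictScalars hf hS (n + 1) _ ?_)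
    exact (hT'.hasProjectiveDimensionLT_X₃_iff n (restrictScalars_projective hS _)).1 hM

end ChangeOfRings

section Finsupp

variable {R : Type u} [Ring R]

/-- The direct sum of copies of a short complex of modules. -/
noncomputable def finsuppShortComplex (ι : Type u) (T : ShortComplex (ModuleCat.{u} R)) :
    ShortComplex (ModuleCat.{u} R) where
  X₁ := ModuleCat.of R (ι →₀ T.X₁)
  X₂ := ModuleCat.of R (ι →₀ T.X₂)
  X₃ := ModuleCat.of R (ι →₀ T.X₃)
  f := ModuleCat.ofHom (Finsupp.mapRange.linearMap T.f.hom)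
  g := ModuleCat.ofHom (Finsupp.mapRange.linearMap T.g.hom)
  zero := ModuleCat.hom_ext (LinearMap.ext fun x => Finsupp.ext fun i =>
    congrArg (fun t => t.hom (x i)) T.zero)

lemma shortExact_finsupp (ι : Type u) {T : ShortComplex (ModuleCat.{u} R)} (hT : T.ShortExact) :
    (finsuppShortComplex ι T).ShortExact := by
  have hm : Mono (finsuppShortComplex ι T).f := (ModuleCat.mono_iff_injective _).2
    (Finsupp.mapRange_injective T.f.hom (map_zero _) hT.moduleCat_injective_f)
  have he : Epi (finsuppShortComplex ι T).g := (ModuleCat.epi_iff_surjective _).2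
    (Finsupp.mapRange_surjective T.g.hom (map_zero _) hT.moduleCat_surjective_g)
  refine ⟨(ShortComplex.moduleCat_exact_iff _).2 fun (x : ι →₀ T.X₂) hx => ?_⟩
  have hx' : ∀ i, ∃ y, T.f.hom y = x i := fun i =>
    (ShortComplex.moduleCat_exact_iff _).1 hT.exact (x i) (DFunLike.congr_fun (F := ι →₀ T.X₃) hx i)
  choose y hy using hx'
  have hfin : (Function.support y).Finite := x.hasFiniteSupport.subset fun i hi h0 => hi
    (hT.moduleCat_injective_f ((hy i).trans (h0.trans (map_zero _).symm)))
  exact ⟨Finsupp.ofSupportFinite y hfin, Finsupp.ext hy⟩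

lemma hasProjectiveDimensionLT_finsupp (ι : Type u) (n : ℕ) (M : ModuleCat.{u} R)
    (hM : HasProjectiveDimensionLT M n) :
    HasProjectiveDimensionLT (ModuleCat.of R (ι →₀ M)) n := by
  match n with
  | 0 =>
    rw [hasProjectiveDimensionLT_zero_iff_isZero] at hM ⊢
    rw [ModuleCat.isZero_iff_subsingleton] at hM ⊢
    exact inferInstanceAs (Subsingleton (ι →₀ M))
  | 1 =>
    rw [← projective_iff_hasProjectiveDimensionLT_one, ← IsProjective.iff_projective] at hM ⊢
    obtain ⟨s, hs⟩ := Module.projective_def.1 hM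
    refine Module.Projective.of_split (P := ι →₀ M) (M := ι →₀ (M →₀ R))
      (Finsupp.mapRange.linearMap s)
      (Finsupp.mapRange.linearMap (Finsupp.linearCombination R id)) ?_
    refine LinearMap.ext fun x => Finsupp.ext fun i => ?_
    simpa using hs (x i)
  | n + 2 =>
    have hT := M.shortExact_projectiveShortComplex
    let T := M.projectiveShortComplex
    have hT' := shortExact_finsupp ι hT
    have hp : Projective (finsuppShortComplex ι T).X₂ := by
      rw [projective_iff_hasProjectiveDimensionLT_one]
      exact hasProjectiveDimensionLT_finsupp ι 1 T.X₂
        (projective_iff_hasProjectiveDimensionLT_one.1 inferInstance)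
    refine (hT'.hasProjectiveDimensionLT_X₃_iff n hp).2
      (hasProjectiveDimensionLT_finsupp ι (n + 1) T.X₁ ?_)
    exact (hT.hasProjectiveDimensionLT_X₃_iff n inferInstance).1 hM

end Finsupp

/-! ### Comparison of `Hom(DA, -)` and `Hom(DB, -)` -/

section QuotientMap

lemma RingHom.op_surjective {R S : Type*} [Ring R] [Ring S] {f : R →+* S}
    (hf : Function.Surjective f) : Function.Surjective (RingHom.op f) := fun s => by
  obtain ⟨r, hr⟩ := hf s.unop
  exact ⟨MulOpposite.op r, congrArg MulOpposite.op hr⟩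

variable {k A B : Type u} [Field k] [Ring A] [Ring B] [Algebra k A] [Algebra k B]
  {π : A →+* B} {e : A}

/-- When the kernel of `π : A → B` is `eA`, the right module `B` is the summand `(1 - e)A` of `A`.

The hypothesis `π x = 0 ↔ e x = x` expresses that the kernel is `eA`. -/
lemma projective_restrictScalars_op (he : IsIdempotentElem e) (hπ : Function.Surjective π)
    (hker : ∀ x, π x = 0 ↔ e * x = x) :
    Projective ((ModuleCat.restrictScalars.{u} (RingHom.op π)).obj (ModuleCat.of Bᵐᵒᵖ Bᵐᵒᵖ)) := by
  -- the section `π a ↦ (1 - e) a`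
  let i : Bᵐᵒᵖ → Aᵐᵒᵖ := fun b => op ((1 - e) * Function.surjInv hπ b.unop)
  have hi : ∀ a : A, i (op (π a)) = op ((1 - e) * a) := fun a => by
    refine congrArg op (sub_eq_zero.1 ?_)
    have h := (hker (Function.surjInv hπ (π a) - a)).1 (by
      rw [map_sub, Function.surjInv_eq hπ, sub_self])
    rw [unop_op, ← mul_sub, sub_mul, one_mul, h, sub_self]
  have hπ' : ∀ b : Bᵐᵒᵖ, ∃ a : A, op (π a) = b := fun b =>
    (hπ b.unop).imp fun a ha => congrArg op ha
  have hπe : π e = 0 := (hker e).2 he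
  let N := (ModuleCat.restrictScalars.{u} (RingHom.op π)).obj (ModuleCat.of Bᵐᵒᵖ Bᵐᵒᵖ)
  let I : N →ₗ[Aᵐᵒᵖ] Aᵐᵒᵖ := LinearMap.mk (AddHom.mk i fun b b' => by
    obtain ⟨a, rfl⟩ := hπ' b
    obtain ⟨a', rfl⟩ := hπ' b'
    rw [hi, hi]
    change i (op (π a + π a')) = _
    rw [← map_add, hi, mul_add]
    rfl) fun c b => by
    obtain ⟨a, rfl⟩ := hπ' b
    change i (op (π a * π c.unop)) = c * i (op (π a))
    rw [← map_mul, hi, hi, ← mul_assoc]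
    rfl
  let P : Aᵐᵒᵖ →ₗ[Aᵐᵒᵖ] N := LinearMap.mk (AddHom.mk (fun a => (op (π a.unop) : Bᵐᵒᵖ))
    fun a a' => congrArg op (map_add π _ _)) fun c a => congrArg op (map_mul π _ _)
  change Projective N
  rw [← N.of_coe, ← IsProjective.iff_projective]
  refine Module.Projective.of_split I P (LinearMap.ext fun b => ?_)
  obtain ⟨a, rfl⟩ := hπ' b
  change op (π (i (op (π a))).unop) = op (π a)
  rw [hi, unop_op, map_mul, map_sub, map_one, hπe, sub_zero, one_mul]

/-- The inclusion `DB → DA` dual to the algebra homomorphism `A → B`. -/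
noncomputable def kDualComap (hk : ∀ c, π (algebraMap k A c) = algebraMap k B c) :
    (ModuleCat.restrictScalars.{u} (RingHom.op π)).obj (ModuleCat.of Bᵐᵒᵖ (KDual k B)) ⟶
      ModuleCat.of Aᵐᵒᵖ (KDual k A) :=
  ModuleCat.ofHom (X := (ModuleCat.restrictScalars.{u} (RingHom.op π)).obj
      (ModuleCat.of Bᵐᵒᵖ (KDual k B)))
    { toFun := fun (g : KDual k B) => (show KDual k A from
        { toFun := fun x => g.toLin (π x)
          map_add' := fun x y => by rw [map_add, map_add]
          map_smul' := fun c x => by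
            rw [Algebra.smul_def, map_mul, hk, ← Algebra.smul_def, map_smul, RingHom.id_apply] })
      map_add' := fun g g' => rfl
      map_smul' := fun a (g : KDual k B) => KDual.ext_toLin fun x =>
        congrArg g.toLin (map_mul π a.unop x).symm }

lemma toLin_kDualComap (hk : ∀ c, π (algebraMap k A c) = algebraMap k B c) (g : KDual k B) (x : A) :
    KDual.toLin ((kDualComap hk).hom g) x = g.toLin (π x) := rfl

lemma smul_kDualComap (hk : ∀ c, π (algebraMap k A c) = algebraMap k B c) (a : A) (g : KDual k B) :
    a • ((kDualComap hk).hom g : KDual k A) = (kDualComap hk).hom (π a • g : KDual k B) :=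
  KDual.ext_toLin fun x => congrArg g.toLin (map_mul π x a)

/-- The map `Hom_A(DA, X) → Hom_B(DB, Hom_A(B, X)) = Hom_A(DB, X)` given by restriction along
`DB → DA`. -/
noncomputable def homKDualComparison (hk : ∀ c, π (algebraMap k A c) = algebraMap k B c) :
    homKDualFunctor k A ⟶ coext (RingHom.op π) ⋙ homKDualFunctor k B ⋙
      ModuleCat.restrictScalars.{u} (RingHom.op π) where
  app X := ModuleCat.ofHom (Y := (ModuleCat.restrictScalars.{u} (RingHom.op π)).obj
      ((homKDualFunctor k B).obj ((coext (RingHom.op π)).obj X)))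
    { toFun := fun (φ : HomKDual k A X) =>
        (HomKDual.ofHom (ModuleCat.RestrictionCoextensionAdj.HomEquiv.fromRestriction
          (RingHom.op π) (X := X) (Y := ModuleCat.of Bᵐᵒᵖ (KDual k B))
            (kDualComap hk ≫ ModuleCat.ofHom φ.toHom)).hom)
      map_add' := fun φ ψ => rfl
      map_smul' := fun a (φ : HomKDual k A X) => by
        refine HomKDual.ext_toHom fun g => ?_
        refine (ModuleCat.CoextendScalars.equiv (RingHom.op π) X).injective
          (LinearMap.ext fun (s : Bᵐᵒᵖ) => ?_)
        change φ.toHom (a.unop • ((kDualComap hk).hom (s • g : KDual k B) : KDual k A)) =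
          φ.toHom ((kDualComap hk).hom (s • (π a.unop • g) : KDual k B))
        rw [smul_kDualComap, smul_comm] }
  naturality X Y f := rfl

lemma homKDualComparison_app_apply (hk : ∀ c, π (algebraMap k A c) = algebraMap k B c)
    (X : ModuleCat.{u} Aᵐᵒᵖ) (φ : HomKDual k A X) (g : KDual k B) (s : Bᵐᵒᵖ) :
    ModuleCat.CoextendScalars.equiv (RingHom.op π) X
      (HomKDual.toHom (A := B) (X := (coext (RingHom.op π)).obj X)
        (((homKDualComparison hk).app X).hom φ) g) s =
      φ.toHom ((kDualComap hk).hom (s • g : KDual k B)) := rfl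

lemma homKDualComparison_app_eq_zero_iff (hk : ∀ c, π (algebraMap k A c) = algebraMap k B c)
    (X : ModuleCat.{u} Aᵐᵒᵖ) (φ : HomKDual k A X) :
    ((homKDualComparison hk).app X).hom φ = 0 ↔
      ∀ g : KDual k B, φ.toHom ((kDualComap hk).hom g) = 0 := by
  constructor
  · intro h g
    have h1 := homKDualComparison_app_apply hk X φ g 1
    rw [h, one_smul] at h1
    exact h1.symm
  · intro h
    refine HomKDual.ext_toHom fun g => ?_
    refine (ModuleCat.CoextendScalars.equiv (RingHom.op π) X).injective
      (LinearMap.ext fun (s : Bᵐᵒᵖ) => ?_)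
    exact (homKDualComparison_app_apply hk X φ g s).trans (h _)

lemma kDualComap_injective (hk : ∀ c, π (algebraMap k A c) = algebraMap k B c)
    (hπ : Function.Surjective π) : Function.Injective (kDualComap hk).hom := by
  intro (g : KDual k B) (g' : KDual k B) h
  refine KDual.ext_toLin (f := g) (g := g') fun y => ?_
  obtain ⟨x, rfl⟩ := hπ y
  rw [← toLin_kDualComap hk, h, toLin_kDualComap]

/-- Maps from `DB` to an injective `A`-module extend along `DB ⊆ DA`. -/
lemma homKDualComparison_app_surjective (hk : ∀ c, π (algebraMap k A c) = algebraMap k B c)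
    (hπ : Function.Surjective π) (X : ModuleCat.{u} Aᵐᵒᵖ) [Injective X] :
    Function.Surjective ((homKDualComparison hk).app X).hom := by
  intro ψ
  let ψ' : ModuleCat.of Bᵐᵒᵖ (KDual k B) ⟶ (ModuleCat.coextendScalars (RingHom.op π)).obj X :=
    ModuleCat.ofHom (HomKDual.toHom (A := B) (X := (coext (RingHom.op π)).obj X) ψ)
  have hm : Mono (kDualComap hk) := (ModuleCat.mono_iff_injective _).2 (kDualComap_injective hk hπ)
  let φ : ModuleCat.of Aᵐᵒᵖ (KDual k A) ⟶ X := Injective.factorThru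
    (ModuleCat.RestrictionCoextensionAdj.HomEquiv.toRestriction (RingHom.op π) ψ') (kDualComap hk)
  have hφ : kDualComap hk ≫ φ =
      ModuleCat.RestrictionCoextensionAdj.HomEquiv.toRestriction (RingHom.op π) ψ' :=
    Injective.comp_factorThru _ _
  refine ⟨HomKDual.ofHom φ.hom, HomKDual.ext_toHom fun g => ?_⟩
  refine (ModuleCat.CoextendScalars.equiv (RingHom.op π) X).injective
    (LinearMap.ext fun (s : Bᵐᵒᵖ) => ?_)
  refine (homKDualComparison_app_apply hk X _ g s).trans ?_
  refine (congrArg (fun t => t.hom (s • g : KDual k B)) hφ).trans ?_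
  change ModuleCat.CoextendScalars.equiv (RingHom.op π) X (ψ'.hom (s • g)) (1 : Bᵐᵒᵖ) = _
  rw [map_smul]
  refine (ModuleCat.CoextendScalars.smul_apply (RingHom.op π) X (ψ'.hom g) s 1).trans ?_
  rw [one_mul]
  rfl

/-- A map `φ : DA → X` that vanishes on `DB` lies in `Hom(DA, X) e A` when `X` is injective.
For a basis `b_s` of `A`, the space `DB` is the common kernel of the left multiplications by the
`e b_s` on `DA`; by injectivity `φ` factors through them, that is `φ = ∑ ψ_s ∘ (e b_s)`, and
`ψ_s ∘ (e b_s) = ψ_s e b_s`. -/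
lemma mem_idemTrace_of_homKDualComparison_eq_zero [Module.Finite k A]
    (hk : ∀ c, π (algebraMap k A c) = algebraMap k B c)
    (hπ : Function.Surjective π) (hker : ∀ x, π x = 0 ↔ e * x = x)
    (X : ModuleCat.{u} Aᵐᵒᵖ) [Injective X] (φ : HomKDual k A X)
    (hφ : ((homKDualComparison hk).app X).hom φ = 0) : φ ∈ idemTrace e (HomKDual k A X) := by
  rw [homKDualComparison_app_eq_zero_iff] at hφ
  let β := Module.finBasis k A
  -- `DA → (DA)^m` with kernel the forms vanishing on `eA`
  let j : KDual k A →ₗ[Aᵐᵒᵖ] (Fin (Module.finrank k A) → KDual k A) :=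
    LinearMap.pi fun s => KDual.leftMul k A (e * β s)
  have hj : ∀ f, j f = 0 → ∃ g : KDual k B, (kDualComap hk).hom g = f := by
    intro f hf
    have h0 : ∀ x y, f.toLin (x * (e * y)) = 0 := by
      intro x y
      have h1 : ∀ s, f.toLin (x * (e * β s)) = 0 := fun s =>
        congrArg (fun t => KDual.toLin (t s) x) hf
      have h2 : f.toLin ∘ₗ LinearMap.mulLeft k (x * e) = 0 := β.ext fun s => by
        simpa [mul_assoc] using h1 s
      simpa [mul_assoc] using LinearMap.congr_fun h2 y
    have h1 : ∀ x, π x = 0 → f.toLin x = 0 := fun x hx => by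
      rw [← (hker x).1 hx, ← one_mul (e * x), h0]
    let g : KDual k B := (show B →ₗ[k] k from
      { toFun := fun y => f.toLin (Function.surjInv hπ y)
        map_add' := fun y y' => by
          rw [← map_add, ← sub_eq_zero, ← map_sub]
          exact h1 _ (by simp [Function.surjInv_eq])
        map_smul' := fun c y => by
          rw [RingHom.id_apply, ← map_smul, ← sub_eq_zero, ← map_sub]
          exact h1 _ (by simp [Function.surjInv_eq, Algebra.smul_def, hk]) })
    refine ⟨g, KDual.ext_toLin fun x => ?_⟩
    rw [toLin_kDualComap]
    change f.toLin (Function.surjInv hπ (π x)) = f.toLin x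
    rw [← sub_eq_zero, ← map_sub]
    exact h1 _ (by simp [Function.surjInv_eq])
  have hφj : LinearMap.ker j ≤ LinearMap.ker φ.toHom := fun f hf => by
    obtain ⟨g, rfl⟩ := hj f hf
    exact hφ g
  let i : KDual k A ⧸ LinearMap.ker j →ₗ[Aᵐᵒᵖ] (Fin (Module.finrank k A) → KDual k A) :=
    (LinearMap.ker j).liftQ j le_rfl
  have hi : Mono (ModuleCat.ofHom i) := (ModuleCat.mono_iff_injective _).2
    (LinearMap.ker_eq_bot.1 (Submodule.ker_liftQ_eq_bot _ _ _ le_rfl))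
  let ψ : ModuleCat.of Aᵐᵒᵖ (Fin (Module.finrank k A) → KDual k A) ⟶ X :=
    Injective.factorThru (ModuleCat.ofHom ((LinearMap.ker j).liftQ φ.toHom hφj))
      (ModuleCat.ofHom i)
  have hψ : ∀ f, ψ.hom (j f) = φ.toHom f := fun f =>
    congrArg (fun t => t.hom (Submodule.Quotient.mk f)) (Injective.comp_factorThru
      (ModuleCat.ofHom ((LinearMap.ker j).liftQ φ.toHom hφj)) (ModuleCat.ofHom i))
  let ψs : Fin (Module.finrank k A) → HomKDual k A X := fun s =>
    HomKDual.ofHom (ψ.hom ∘ₗ LinearMap.single Aᵐᵒᵖ (fun _ => KDual k A) s)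
  have hsum : φ = ∑ s, op (β s) • op e • ψs s := by
    have hs : ∀ (t : Finset (Fin (Module.finrank k A)))
        (F : Fin (Module.finrank k A) → HomKDual k A X) (f : KDual k A),
        (∑ s ∈ t, F s).toHom f = ∑ s ∈ t, (F s).toHom f := fun t F f => by
      let ev : HomKDual k A X →+ X :=
        { toFun := fun φ => φ.toHom f, map_zero' := rfl, map_add' := fun _ _ => rfl }
      exact map_sum ev F t
    refine HomKDual.ext_toHom fun f => ?_
    rw [hs, ← hψ, ← LinearMap.sum_single_apply (φ := fun _ => KDual k A) (j f), map_sum]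
    refine Finset.sum_congr rfl fun s _ => ?_
    change ψ.hom (Pi.single s ((e * β s) • f)) = ψ.hom (Pi.single s (e • β s • f))
    rw [mul_smul]
  rw [hsum]
  exact Submodule.sum_mem _ fun s _ => Submodule.smul_mem _ _ (op_smul_mem_idemTrace _)

lemma homKDualComparison_app_idemTrace (he : IsIdempotentElem e)
    (hk : ∀ c, π (algebraMap k A c) = algebraMap k B c) (hker : ∀ x, π x = 0 ↔ e * x = x)
    (X : ModuleCat.{u} Aᵐᵒᵖ) (φ : HomKDual k A X) (hφ : φ ∈ idemTrace e (HomKDual k A X)) :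
    ((homKDualComparison hk).app X).hom φ = 0 := by
  have : idemTrace e (HomKDual k A X) ≤ LinearMap.ker ((homKDualComparison hk).app X).hom := by
    refine Submodule.span_le.2 ?_
    rintro - ⟨ψ, rfl⟩
    change ((homKDualComparison hk).app X).hom (op e • ψ) = 0
    refine (((homKDualComparison hk).app X).hom.map_smul (op e) ψ).trans ?_
    change op (π e) • (show HomKDual k B ((coext (RingHom.op π)).obj X) from
      ((homKDualComparison hk).app X).hom ψ) = 0
    rw [(hker e).2 he, MulOpposite.op_zero, zero_smul]
  exact this hφ

end QuotientMap

/-! ### The cohomology sequence -/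

section IdemTraceTop

variable {A : Type u} [Ring A] {e : A}

/-- A module generated by its `e`-part is finite as soon as it maps to a noetherian module with a
kernel annihilated by `e`. -/
lemma finite_of_idemTrace_eq_top {P N : Type*} [AddCommGroup P] [Module Aᵐᵒᵖ P] [AddCommGroup N]
    [Module Aᵐᵒᵖ N] [IsNoetherian Aᵐᵒᵖ N] (hP : idemTrace e P = ⊤) (ψ : P →ₗ[Aᵐᵒᵖ] N)
    (hψ : ∀ p, ψ p = 0 → op e • p = 0) : Module.Finite Aᵐᵒᵖ P := by
  -- a finitely generated submodule of `P` with the same image contains every `p e`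
  obtain ⟨m, g, hg⟩ := Module.Finite.exists_fin' Aᵐᵒᵖ (LinearMap.range ψ)
  obtain ⟨f, hf⟩ := Module.projective_lifting_property ψ.rangeRestrict g
    ψ.surjective_rangeRestrict
  refine Module.Finite.of_surjective f (LinearMap.range_eq_top.1 ?_)
  rw [eq_top_iff, ← hP]
  refine Submodule.span_le.2 ?_
  rintro - ⟨p, rfl⟩
  obtain ⟨x, hx⟩ := hg (ψ.rangeRestrict p)
  rw [← hf] at hx
  have h := hψ (p - f x) (by
    rw [map_sub, sub_eq_zero]
    exact (congrArg Subtype.val hx).symm)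
  rw [smul_sub, sub_eq_zero] at h
  exact ⟨op e • x, (map_smul f _ _).trans h.symm⟩

lemma idemTrace_eq_top_of_surjective {N N' : Type*} [AddCommGroup N] [Module Aᵐᵒᵖ N]
    [AddCommGroup N'] [Module Aᵐᵒᵖ N'] (f : N →ₗ[Aᵐᵒᵖ] N') (hf : Function.Surjective f)
    (hN : idemTrace e N = ⊤) : idemTrace e N' = ⊤ := by
  refine eq_top_iff.2 fun x _ => ?_
  obtain ⟨n, rfl⟩ := hf x
  exact map_mem_idemTrace f n (hN ▸ Submodule.mem_top)

lemma isZero_of_epi_of_idemTrace_eq_top {T N : ModuleCat.{u} Aᵐᵒᵖ} (f : T ⟶ N) [Epi f]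
    (hT : ∀ t : T, op e • t = 0) (hN : idemTrace e N = ⊤) : IsZero N := by
  rw [ModuleCat.isZero_iff_subsingleton]
  refine ⟨fun x y => ?_⟩
  have h : idemTrace e N ≤ ⊥ := by
    refine Submodule.span_le.2 ?_
    rintro - ⟨n, rfl⟩
    obtain ⟨t, rfl⟩ := (ModuleCat.epi_iff_surjective f).1 ‹_› n
    change op e • f.hom t = 0
    rw [← map_smul, hT, map_zero]
  rw [hN] at h
  have h0 : ∀ x : N, x = 0 := fun x => h (Submodule.mem_top : x ∈ ⊤)
  rw [h0 x, h0 y]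

end IdemTraceTop

section TraceSequence

variable {k A B : Type u} [Field k] [Ring A] [Ring B] [Algebra k A] [Algebra k B]
  {π : A →+* B} {e : A}

/-- For a complex `L` of injectives, `Hom(DA, L) e A` is a complex of projectives with von Neumann
regular differentials, so its cohomology consists of direct summands of its terms. -/
lemma homology_idemTrace [Module.Finite k A] (he : IsIdempotentElem e)
    (h_str : ∀ a : A, (1 - e) * a * e = 0) (h_ss : IsSemisimpleRing he.Corner)
    (L : CochainComplex (ModuleCat.{u} Aᵐᵒᵖ) ℤ) [∀ i, Injective (L.X i)] (j : ℤ) :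
    Projective ((((homKDualFunctor k A ⋙ idemTraceFunctor e).mapHomologicalComplex
      (.up ℤ)).obj L).homology j) ∧
    idemTrace e ((((homKDualFunctor k A ⋙ idemTraceFunctor e).mapHomologicalComplex
      (.up ℤ)).obj L).homology j) = ⊤ := by
  have hp : ∀ i, Projective ((homKDualFunctor k A).obj (L.X i)) := fun i =>
    HomKDual.projective_of_injective (L.X i)
  let S := (((homKDualFunctor k A ⋙ idemTraceFunctor e).mapHomologicalComplex (.up ℤ)).obj L).sc j
  obtain ⟨s, hs⟩ := exists_idemTraceFunctor_map_comp_comp he h_str h_ss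
    ((homKDualFunctor k A).map (L.d ((ComplexShape.up ℤ).prev j) j))
  obtain ⟨t, ht⟩ := exists_idemTraceFunctor_map_comp_comp he h_str h_ss
    ((homKDualFunctor k A).map (L.d j ((ComplexShape.up ℤ).next j)))
  obtain ⟨r⟩ := ShortComplex.nonempty_retract_homology S s t hs ht
  have h2 : Projective S.X₂ := projective_idemTraceFunctor_obj h_str _
  refine ⟨r.projective, idemTrace_eq_top_of_surjective r.r.hom
    (fun y => ⟨r.i.hom y, congrArg (fun f => f.hom y) r.retract⟩) ?_⟩
  exact idemTrace_idemTrace he _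

/-- For a complex `L`, the sequence of complexes
`0 → Hom_A(DA, L) e A → Hom_A(DA, L) → Hom_B(DB, Hom_A(B, L)) → 0`. -/
noncomputable def traceSequence (e : A) (hk : ∀ c, π (algebraMap k A c) = algebraMap k B c)
    (hker : ∀ x, π x = 0 ↔ e * x = x) (he : IsIdempotentElem e)
    (L : CochainComplex (ModuleCat.{u} Aᵐᵒᵖ) ℤ) :
    ShortComplex (CochainComplex (ModuleCat.{u} Aᵐᵒᵖ) ℤ) :=
  ShortComplex.mk
    ((NatTrans.mapHomologicalComplex (F := homKDualFunctor k A ⋙ idemTraceFunctor e)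
      (G := homKDualFunctor k A)
      (Functor.whiskerLeft (homKDualFunctor k A) (idemTraceι e)) (.up ℤ)).app L)
    ((NatTrans.mapHomologicalComplex (homKDualComparison hk) (.up ℤ)).app L) (by
      ext i x
      exact homKDualComparison_app_idemTrace he hk hker (L.X i) x.1 x.2)

/-- The sequence `traceSequence` is exact when `L` is a complex of injectives. -/
lemma traceSequence_shortExact [Module.Finite k A]
    (hk : ∀ c, π (algebraMap k A c) = algebraMap k B c)
    (hπ : Function.Surjective π)
    (hker : ∀ x, π x = 0 ↔ e * x = x) (he : IsIdempotentElem e)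
    (L : CochainComplex (ModuleCat.{u} Aᵐᵒᵖ) ℤ) [∀ i, Injective (L.X i)] :
    (traceSequence e hk hker he L).ShortExact := by
  refine HomologicalComplex.shortExact_of_degreewise_shortExact _ fun i => ?_
  refine ShortComplex.ShortExact.mk' ?_ ?_ ?_
  · refine (ShortComplex.moduleCat_exact_iff _).2 fun x hx => ?_
    exact ⟨⟨x, mem_idemTrace_of_homKDualComparison_eq_zero hk hπ hker (L.X i) x hx⟩, rfl⟩
  · exact (ModuleCat.mono_iff_injective _).2 Subtype.val_injective
  · exact (ModuleCat.epi_iff_surjective _).2 (homKDualComparison_app_surjective hk hπ (L.X i))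

/-- The cohomology of the third term of `traceSequence` is the restriction of a `B`-module. -/
noncomputable def traceSequenceHomologyIso (hk : ∀ c, π (algebraMap k A c) = algebraMap k B c)
    (hker : ∀ x, π x = 0 ↔ e * x = x) (he : IsIdempotentElem e)
    (L : CochainComplex (ModuleCat.{u} Aᵐᵒᵖ) ℤ) (j : ℤ) :
    (traceSequence e hk hker he L).X₃.homology j ≅
      (ModuleCat.restrictScalars.{u} (RingHom.op π)).obj
        ((((homKDualFunctor k B).mapHomologicalComplex (.up ℤ)).obj
          (((coext (RingHom.op π)).mapHomologicalComplex (.up ℤ)).obj L)).homology j) :=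
  ShortComplex.mapHomologyIso ((((homKDualFunctor k B).mapHomologicalComplex (.up ℤ)).obj
          (((coext (RingHom.op π)).mapHomologicalComplex (.up ℤ)).obj L)).sc j)
          (ModuleCat.restrictScalars.{u} (RingHom.op π))

lemma op_smul_eq_zero_of_iso_restrictScalars (h : π e = 0) {N : ModuleCat.{u} Aᵐᵒᵖ}
    {M : ModuleCat.{u} Bᵐᵒᵖ} (i : N ≅ (ModuleCat.restrictScalars.{u} (RingHom.op π)).obj M)
    (x : N) : op e • x = 0 := by
  refine i.toLinearEquiv.injective ?_
  rw [map_smul, map_zero]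
  change op (π e) • (show M from i.toLinearEquiv x) = 0
  rw [h, MulOpposite.op_zero, zero_smul]

/-- If `Hom_A(DA, L)` is concentrated in degree `n + 1` and `Hom_B(DB, Hom_A(B, L))` in degrees at
most `n`, then the latter is concentrated in degree `n`, and the long exact sequence of
`traceSequence` shrinks to `0 → Hⁿ → P → Hⁿ⁺¹ → 0` with `P` finitely generated projective.

In the other degrees, the cohomology of `Hom_A(DA, L) e A` is both generated by its `e`-part and a
quotient of a module killed by `e`, hence zero. -/
lemma exists_shortExact_homology [Module.Finite k A] [IsNoetherianRing Aᵐᵒᵖ]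
    (hk : ∀ c, π (algebraMap k A c) = algebraMap k B c) (hπ : Function.Surjective π)
    (hker : ∀ x, π x = 0 ↔ e * x = x) (he : IsIdempotentElem e)
    (h_str : ∀ a : A, (1 - e) * a * e = 0) (h_ss : IsSemisimpleRing he.Corner)
    (L : CochainComplex (ModuleCat.{u} Aᵐᵒᵖ) ℤ) [∀ i, Injective (L.X i)] (n : ℤ)
    (hA : ∀ j, j ≠ n + 1 →
      IsZero ((((homKDualFunctor k A).mapHomologicalComplex (.up ℤ)).obj L).homology j))
    (hA' : Module.Finite Aᵐᵒᵖ
      ((((homKDualFunctor k A).mapHomologicalComplex (.up ℤ)).obj L).homology (n + 1)))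
    (hB : ∀ j, n < j → IsZero ((((homKDualFunctor k B).mapHomologicalComplex (.up ℤ)).obj
      (((coext (RingHom.op π)).mapHomologicalComplex (.up ℤ)).obj L)).homology j)) :
    (∀ j, j ≠ n → IsZero ((((homKDualFunctor k B).mapHomologicalComplex (.up ℤ)).obj
      (((coext (RingHom.op π)).mapHomologicalComplex (.up ℤ)).obj L)).homology j)) ∧
    ∃ T : ShortComplex (ModuleCat.{u} Aᵐᵒᵖ), T.ShortExact ∧ Module.Finite Aᵐᵒᵖ T.X₂ ∧
      Projective T.X₂ ∧
      Nonempty (T.X₁ ≅ (ModuleCat.restrictScalars.{u} (RingHom.op π)).obj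
        ((((homKDualFunctor k B).mapHomologicalComplex (.up ℤ)).obj
          (((coext (RingHom.op π)).mapHomologicalComplex (.up ℤ)).obj L)).homology n)) ∧
      Nonempty (T.X₃ ≅
        (((homKDualFunctor k A).mapHomologicalComplex (.up ℤ)).obj L).homology (n + 1)) := by
  have hS := traceSequence_shortExact hk hπ hker he L
  set S := traceSequence e hk hker he L with hSdef
  let φ := traceSequenceHomologyIso hk hker he L
  have hkill : ∀ j (t : S.X₃.homology j), op e • t = 0 := fun j =>
    op_smul_eq_zero_of_iso_restrictScalars ((hker e).2 he) (φ j)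
  have hproj := homology_idemTrace (k := k) he h_str h_ss L
  have h2 : ∀ j, j ≠ n + 1 → IsZero (S.X₂.homology j) := hA
  have h1 : ∀ j, j ≠ n + 1 → IsZero (S.X₁.homology j) := fun j hj => by
    have hr : (ComplexShape.up ℤ).Rel (j - 1) j := by simp
    have : Epi (hS.δ (j - 1) j hr) := hS.epi_δ _ _ _ (h2 j hj)
    exact isZero_of_epi_of_idemTrace_eq_top (hS.δ (j - 1) j hr) (hkill _) (hproj j).2
  constructor
  · intro j hj
    rcases lt_or_gt_of_ne hj with h | h
    · have h3 : IsZero (S.X₃.homology j) :=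
        (hS.homology_exact₃ j (j + 1) (by simp)).isZero_of_both_zeros
          ((h2 j (by lia)).eq_of_src _ _) ((h1 (j + 1) (by lia)).eq_of_tgt _ _)
      have h4 := h3.of_iso (φ j).symm
      rw [ModuleCat.isZero_iff_subsingleton] at h4 ⊢
      exact h4
    · exact hB j h
  · have hz : IsZero (S.X₃.homology (n + 1)) :=
      ((ModuleCat.restrictScalars.{u} (RingHom.op π)).map_isZero (hB (n + 1) (by lia))).of_iso
        (φ (n + 1))
    have ex := hS.homology_exact₁ n (n + 1) (by simp)
    have hm : Mono (hS.δ n (n + 1) (by simp)) :=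
      (hS.homology_exact₃ n (n + 1) (by simp)).mono_g ((h2 n (by lia)).eq_of_src _ _)
    have hep : Epi (HomologicalComplex.homologyMap S.f (n + 1)) :=
      (hS.homology_exact₂ (n + 1)).epi_f (hz.eq_of_tgt _ _)
    refine ⟨_, ShortComplex.ShortExact.mk' ex hm hep, ?_, (hproj (n + 1)).1, ⟨φ n⟩, ⟨Iso.refl _⟩⟩
    have : Module.Finite Aᵐᵒᵖ (S.X₂.homology (n + 1)) := hA'
    refine finite_of_idemTrace_eq_top (hproj (n + 1)).2
      (HomologicalComplex.homologyMap S.f (n + 1)).hom fun p hp => ?_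
    obtain ⟨t, rfl⟩ := (ShortComplex.moduleCat_exact_iff _).1 ex p hp
    refine ((hS.δ n (n + 1) (by simp)).hom.map_smul (op e) t).symm.trans ?_
    rw [hkill, map_zero]

end TraceSequence

/-! ### The inverse Serre functor on modules over the quotient -/

section InverseSerreRestriction

attribute [local instance] HasDerivedCategory.standard

open DerivedCategory.Plus

/-- The cohomology of `ν_n⁻¹ X` is computed by an injective resolution `L` of `X`. -/
lemma nonempty_homology_nuInv_iso (k A : Type u) [Field k] [Ring A] [Algebra k A]
    (X : DerivedCategory.Plus (ModuleCat.{u} Aᵐᵒᵖ)) (L : CochainComplex (ModuleCat.{u} Aᵐᵒᵖ) ℤ)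
    (r : ℤ) [L.IsStrictlyGE r] [∀ i, Injective (L.X i)] (e : DerivedCategory.Q.obj L ≅ X.obj)
    (n : ℕ) (i j : ℤ) (h : n + i = j) :
    Nonempty ((homologyFunctor (ModuleCat.{u} Aᵐᵒᵖ) i).obj ((nuInv k A n).obj X) ≅
      (((homKDualFunctor k A).mapHomologicalComplex (.up ℤ)).obj L).homology j) := by
  obtain ⟨e'⟩ := rightDerivedFunctorPlus_injective (homKDualFunctor k A) X L r e
  exact ⟨homologyNuInvIso k A n i j h X ≪≫
    (DerivedCategory.homologyFunctor (ModuleCat.{u} Aᵐᵒᵖ) j).mapIso e' ≪≫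
    (DerivedCategory.homologyFunctorFactors (ModuleCat.{u} Aᵐᵒᵖ) j).app _⟩

variable {k A B : Type u} [Field k] [Ring A] [Ring B] [Algebra k A] [Algebra k B]
  {π : A →+* B} {e : A}

/-- For a `B`-module `M` such that `ν_{n+1}⁻¹ M` over `A` is in `mod A`, the object `ν_n⁻¹ M` over
`B` is a module `M'`, and there is a short exact sequence `0 → M' → P → ν_{n+1}⁻¹ M → 0` of
`A`-modules with `P` finitely generated projective. -/
lemma exists_shortExact_nuInv [Module.Finite k A] [IsNoetherianRing Aᵐᵒᵖ]
    (hk : ∀ c, π (algebraMap k A c) = algebraMap k B c) (hπ : Function.Surjective π)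
    (hker : ∀ x, π x = 0 ↔ e * x = x) (he : IsIdempotentElem e)
    (h_str : ∀ a : A, (1 - e) * a * e = 0) (h_ss : IsSemisimpleRing he.Corner)
    (n : ℕ) (hB : ∀ M : ModuleCat.{u} Bᵐᵒᵖ, HasProjectiveDimensionLE M n)
    (M : ModuleCat.{u} Bᵐᵒᵖ)
    (hM : InModCat A ((nuInv k A (n + 1)).obj ((singleFunctor _ 0).obj
      ((ModuleCat.restrictScalars.{u} (RingHom.op π)).obj M)))) :
    ∃ M' : ModuleCat.{u} Bᵐᵒᵖ,
      Nonempty ((nuInv k B n).obj ((singleFunctor _ 0).obj M) ≅ (singleFunctor _ 0).obj M') ∧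
      ∃ T : ShortComplex (ModuleCat.{u} Aᵐᵒᵖ), T.ShortExact ∧ Module.Finite Aᵐᵒᵖ T.X₂ ∧
        Projective T.X₂ ∧
        Nonempty (T.X₁ ≅ (ModuleCat.restrictScalars.{u} (RingHom.op π)).obj M') ∧
        Nonempty ((singleFunctor _ 0).obj T.X₃ ≅ (nuInv k A (n + 1)).obj ((singleFunctor _ 0).obj
          ((ModuleCat.restrictScalars.{u} (RingHom.op π)).obj M))) := by
  let res := ModuleCat.restrictScalars.{u} (RingHom.op π)
  have hproj := projective_restrictScalars_op he hπ hker
  obtain ⟨h1, h2⟩ := coextendScalars_exact hproj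
  have hfull : res.Full := full_restrictScalars (RingHom.op π) (RingHom.op_surjective hπ)
  obtain ⟨L₀, hL₀, ⟨i₀⟩⟩ := DerivedCategory.Plus.exists_injective_nonempty_iso
    ((singleFunctor (ModuleCat.{u} Aᵐᵒᵖ) 0).obj (res.obj M)) 0
  let L := ((InjectiveObject.ι (ModuleCat.{u} Aᵐᵒᵖ)).mapHomologicalComplex (.up ℤ)).obj L₀.obj
  have hL : ∀ i, Injective (L.X i) := fun i => (L₀.obj.X i).property
  have hL' : CochainComplex.IsStrictlyGE L 0 := inferInstance
  let i₁ : DerivedCategory.Q.obj L ≅ (DerivedCategory.singleFunctor _ 0).obj (res.obj M) :=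
    DerivedCategory.Plus.ι.mapIso i₀
  -- `Hom_A(B, L)` is an injective resolution of the `B`-module `Hom_A(B, M) = M`
  let c := coext (RingHom.op π)
  let L' := (c.mapHomologicalComplex (.up ℤ)).obj L
  have hc : ∀ i, Injective (L'.X i) := fun i => coextendScalars_injective (L.X i)
  have hc' : CochainComplex.IsStrictlyGE L' 0 := inferInstance
  let i₂ : DerivedCategory.Q.obj L' ≅ (DerivedCategory.singleFunctor _ 0).obj M :=
    (c.mapDerivedCategoryFactors.app L).symm ≪≫ c.mapDerivedCategory.mapIso i₁ ≪≫
      (c.mapDerivedCategorySingleFunctor 0).app (res.obj M) ≪≫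
      (DerivedCategory.singleFunctor _ 0).mapIso
        (asIso ((restrictCoextAdj (RingHom.op π)).unit.app M)).symm
  have hHA : ∀ (i j : ℤ), ((n + 1 : ℕ) : ℤ) + i = j → _ := fun i j h =>
    nonempty_homology_nuInv_iso k A ((singleFunctor _ 0).obj (res.obj M)) L 0 i₁ (n + 1) i j h
  have hHB : ∀ (i j : ℤ), (n : ℤ) + i = j → _ := fun i j h =>
    nonempty_homology_nuInv_iso k B ((singleFunctor _ 0).obj M) L' 0 i₂ n i j h
  obtain ⟨hM₁, hM₂⟩ := (inModCat_iff _).1 hM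
  obtain ⟨a⟩ := hHA 0 (n + 1) (by simp)
  obtain ⟨hB', T, hT, hT₂, hT₂', ⟨t₁⟩, ⟨t₃⟩⟩ := exists_shortExact_homology hk hπ hker he h_str h_ss
    L n (fun j hj => (hM₁ (j - (n + 1)) (by lia)).of_iso (hHA _ j (by push_cast; ring)).some.symm)
    (Module.Finite.equiv a.toLinearEquiv) (fun j hj => by
      have := hasInjectiveDimensionLT_of_forall_hasProjectiveDimensionLT (n + 1) hB M
      refine (isZero_homology_rightDerivedFunctorPlus_of_hasInjectiveDimensionLT
        (homKDualFunctor k B) n M j hj).of_iso ?_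
      exact (hHB (j - n) j (by ring)).some.symm ≪≫ homologyNuInvIso k B n (j - n) j (by ring) _)
  obtain ⟨s⟩ := exists_iso_single_of_isZero_homology
    ((nuInv k B n).obj ((singleFunctor _ 0).obj M))
    fun j hj => (hB' (n + j) (by lia)).of_iso (hHB j _ rfl).some
  obtain ⟨s'⟩ := exists_iso_single_of_isZero_homology _ hM₁
  obtain ⟨b⟩ := hHB 0 n (by simp)
  exact ⟨_, ⟨s ≪≫ (singleFunctor _ 0).mapIso b⟩, T, hT, hT₂, hT₂', ⟨t₁⟩,
    ⟨(singleFunctor _ 0).mapIso (t₃ ≪≫ a.symm) ≪≫ s'.symm⟩⟩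

/-- If every iterate of `ν_{n+1}⁻¹` for `A` sends the `B`-module `M` to `mod A`, then every iterate
of `ν_n⁻¹` for `B` sends it to `mod B`. -/
lemma NuInvStable.of_restrictScalars [Module.Finite k A] [IsNoetherianRing Aᵐᵒᵖ]
    (hk : ∀ c, π (algebraMap k A c) = algebraMap k B c) (hπ : Function.Surjective π)
    (hker : ∀ x, π x = 0 ↔ e * x = x) (he : IsIdempotentElem e)
    (h_str : ∀ a : A, (1 - e) * a * e = 0) (h_ss : IsSemisimpleRing he.Corner)
    (n : ℕ) (hA : ∀ M : ModuleCat.{u} Aᵐᵒᵖ, HasProjectiveDimensionLE M (n + 1))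
    (hA' : NuInvStable k A (n + 1) ((singleFunctor _ 0).obj (ModuleCat.of Aᵐᵒᵖ A)))
    (hB : ∀ M : ModuleCat.{u} Bᵐᵒᵖ, HasProjectiveDimensionLE M n)
    (M : ModuleCat.{u} Bᵐᵒᵖ)
    (hM : NuInvStable k A (n + 1) ((singleFunctor _ 0).obj
      ((ModuleCat.restrictScalars.{u} (RingHom.op π)).obj M))) :
    NuInvStable k B n ((singleFunctor _ 0).obj M) := fun i => by
  have hfin : ∀ M : ModuleCat.{u} Bᵐᵒᵖ,
      Module.Finite Aᵐᵒᵖ ((ModuleCat.restrictScalars.{u} (RingHom.op π)).obj M) →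
        Module.Finite Bᵐᵒᵖ M := fun M hM => by
    have : RingHomSurjective (RingHom.op π) := ⟨RingHom.op_surjective hπ⟩
    let f : (ModuleCat.restrictScalars.{u} (RingHom.op π)).obj M →ₛₗ[RingHom.op π] M :=
      { toFun := fun x => x, map_add' := fun _ _ => rfl, map_smul' := fun _ _ => rfl }
    exact Module.Finite.of_surjective f fun x => ⟨x, rfl⟩
  induction i generalizing M with
  | zero => exact (inModCat_single_iff M).2 (hfin M ((inModCat_single_iff _).1 (hM 0)))
  | succ i ih =>
    obtain ⟨M', ⟨s⟩, T, hT, hT₂, hT₂', ⟨t₁⟩, ⟨t₃⟩⟩ :=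
      exists_shortExact_nuInv hk hπ hker he h_str h_ss n hB M (hM 1)
    refine (ih M' ?_).of_iso (nuInv_iterate_iso k B n i s.symm).some
    have : Module.Projective Aᵐᵒᵖ T.X₂ := (IsProjective.iff_projective (R := Aᵐᵒᵖ) T.X₂).2 hT₂'
    obtain ⟨Δ, hΔ, h₁, h₂, h₃⟩ := exists_distTriang_single hT
    have hfin₁ : Module.Finite Aᵐᵒᵖ T.X₁ :=
      Module.Finite.of_injective T.f.hom hT.moduleCat_injective_f
    refine NuInvStable.of_iso ?_ ((singleFunctor _ 0).mapIso t₁)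
    rw [← h₁]
    refine NuInvStable.of_distTriang₁ hA hΔ ?_ ?_ ?_
    · rw [h₁]
      exact (inModCat_single_iff _).2 hfin₁
    · rw [h₂]
      exact NuInvStable.single_of_projective hA' T.X₂
    · rw [h₃]
      exact hM.nuInv_obj.of_iso t₃.symm

end InverseSerreRestriction

/-! ### Global dimension and conclusion -/

section Quotient

/-- If `gl.dim A ≤ n + 1` and `DB` has projective dimension at most `n` over `A`, then
`gl.dim B ≤ n`: every `B`-module is the kernel of a map from a sum of copies of `DB`, of projective
dimension at most `n`, to a module of projective dimension at most `n + 1`. -/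
lemma hasProjectiveDimensionLE_of_kDual {k A B : Type u} [Field k] [Ring A] [Ring B] [Algebra k B]
    [Module.Finite k B] {π : A →+* B} {e : A}
    (hπ : Function.Surjective π) (hker : ∀ x, π x = 0 ↔ e * x = x) (he : IsIdempotentElem e)
    (n : ℕ) (hA : ∀ M : ModuleCat.{u} Aᵐᵒᵖ, HasProjectiveDimensionLE M (n + 1))
    (hD : HasProjectiveDimensionLT ((ModuleCat.restrictScalars.{u} (RingHom.op π)).obj
      (ModuleCat.of Bᵐᵒᵖ (KDual k B))) (n + 1))
    (M : ModuleCat.{u} Bᵐᵒᵖ) : HasProjectiveDimensionLE M n := by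
  have hS := projective_restrictScalars_op he hπ hker
  have hf := RingHom.op_surjective hπ
  have hB : ∀ M : ModuleCat.{u} Bᵐᵒᵖ, HasProjectiveDimensionLT M (n + 2) := fun M =>
    hasProjectiveDimensionLT_of_restrictScalars hf hS _ M (hA _)
  obtain ⟨ι, φ, hφ⟩ := KDual.exists_injective_finsupp k B M
  let φ' : M ⟶ ModuleCat.of Bᵐᵒᵖ (ι →₀ KDual k B) := ModuleCat.ofHom φ
  have hm : Mono φ' := (ModuleCat.mono_iff_injective _).2 hφ
  let T := ShortComplex.mk φ' (cokernel.π φ') (cokernel.condition φ')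
  have hT : T.ShortExact := { exact := ShortComplex.exact_cokernel _ }
  exact hT.hasProjectiveDimensionLT_X₁ (n + 1)
    (hasProjectiveDimensionLT_finsupp ι (n + 1) (ModuleCat.of Bᵐᵒᵖ (KDual k B))
      (hasProjectiveDimensionLT_of_restrictScalars hf hS _ _ hD)) (hB _)

/-- If `(1 - e) A e = 0`, then `AeA = eA`. -/
lemma mem_span_singleton_iff_mul_eq {A : Type*} [Ring A] {e : A} (he : IsIdempotentElem e)
    (h_str : ∀ a : A, (1 - e) * a * e = 0) (x : A) :
    x ∈ TwoSidedIdeal.span {e} ↔ e * x = x := by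
  constructor
  · intro hx
    let I : TwoSidedIdeal A := TwoSidedIdeal.mk' {x | e * x = x} (mul_zero _)
      (fun {x y} hx hy => by
        change e * (x + y) = x + y
        rw [mul_add, show e * x = x from hx, show e * y = y from hy])
      (fun {x} hx => by
        change e * -x = -x
        rw [mul_neg, show e * x = x from hx])
      (fun {x y} hy => by
        change e * (x * y) = x * y
        have hy' : e * y = y := hy
        rw [← hy', ← mul_assoc x, ← mul_idem_eq h_str x]
        simp only [← mul_assoc, he.eq])
      (fun {x y} hx => by
        change e * (x * y) = x * y
        rw [← mul_assoc, show e * x = x from hx])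
    have hI : TwoSidedIdeal.span {e} ≤ I := TwoSidedIdeal.span_le.2 (by
      rintro - rfl
      exact (TwoSidedIdeal.mem_mk' ..).2 he)
    have h : x ∈ I := hI hx
    exact (TwoSidedIdeal.mem_mk' {x | e * x = x} _ _ _ _ _ x).1 h
  · intro hx
    rw [← hx]
    exact TwoSidedIdeal.mul_mem_right _ _ _ (TwoSidedIdeal.subset_span rfl)

end Quotient

section Restriction

attribute [local instance] HasDerivedCategory.standard

lemma NuInvStable.single_restrictScalars {k A B : Type u} [Field k] [Ring A] [Algebra k A]
    [IsNoetherianRing Aᵐᵒᵖ] [Ring B] {π : A →+* B} {e : A}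
    (hπ : Function.Surjective π) (hker : ∀ x, π x = 0 ↔ e * x = x) (he : IsIdempotentElem e)
    {n : ℕ} (h : NuInvStable k A n
      ((DerivedCategory.Plus.singleFunctor _ 0).obj (ModuleCat.of Aᵐᵒᵖ A))) :
    NuInvStable k A n ((DerivedCategory.Plus.singleFunctor _ 0).obj
      ((ModuleCat.restrictScalars.{u} (RingHom.op π)).obj (ModuleCat.of Bᵐᵒᵖ B))) := by
  let res := ModuleCat.restrictScalars.{u} (RingHom.op π)
  let i : res.obj (ModuleCat.of Bᵐᵒᵖ B) ≅ res.obj (ModuleCat.of Bᵐᵒᵖ Bᵐᵒᵖ) :=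
    res.mapIso (X := ModuleCat.of Bᵐᵒᵖ B) (Y := ModuleCat.of Bᵐᵒᵖ Bᵐᵒᵖ)
      (LinearEquiv.toModuleIso (opSelfEquiv B))
  refine NuInvStable.of_iso ?_ ((DerivedCategory.Plus.singleFunctor _ 0).mapIso i.symm)
  have hP : Module.Projective Aᵐᵒᵖ (res.obj (ModuleCat.of Bᵐᵒᵖ Bᵐᵒᵖ)) :=
    (IsProjective.iff_projective (R := Aᵐᵒᵖ) _).2 (projective_restrictScalars_op he hπ hker)
  let p : Aᵐᵒᵖ →ₗ[Aᵐᵒᵖ] res.obj (ModuleCat.of Bᵐᵒᵖ Bᵐᵒᵖ) :=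
    LinearMap.mk (AddHom.mk (fun a => (op (π a.unop) : Bᵐᵒᵖ))
      fun a a' => congrArg op (map_add π _ _)) fun c a => congrArg op (map_mul π _ _)
  have hfin : Module.Finite Aᵐᵒᵖ (res.obj (ModuleCat.of Bᵐᵒᵖ Bᵐᵒᵖ)) :=
    Module.Finite.of_surjective p (RingHom.op_surjective hπ)
  exact h.single_of_projective _

end Restriction

theorem theorem2p8 (k A : Type u) [Field k] [Ring A] [Algebra k A] (d : ℕ) (hd : 1 ≤ d)
    (hA : IsRepresentationInfinite k A d) (e : A) (he : IsIdempotentElem e)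
    (h_str : ∀ a : A, (1 - e) * a * e = 0)
    (h_pd : HasProjectiveDimensionLT (dualIdempotentQuotient k e) d)
    (h_ss : IsSemisimpleRing he.Corner) :
    IsRepresentationInfinite k (IdempotentQuotient e) (d - 1) := by
  obtain ⟨n, rfl⟩ : ∃ n, d = n + 1 := ⟨d - 1, by lia⟩
  rw [Nat.add_sub_cancel]
  have hfin := hA.finiteDimensional
  have hnoeth : IsNoetherianRing Aᵐᵒᵖ := IsNoetherianRing.of_finite k Aᵐᵒᵖ
  let π : A →+* IdempotentQuotient e := Ideal.Quotient.mk (TwoSidedIdeal.span {e}).asIdeal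
  have hπ : Function.Surjective π := Ideal.Quotient.mk_surjective
  have hk : ∀ c, π (algebraMap k A c) = algebraMap k (IdempotentQuotient e) c := fun _ => rfl
  have hker : ∀ x, π x = 0 ↔ e * x = x := fun x => by
    rw [← mem_span_singleton_iff_mul_eq he h_str, ← TwoSidedIdeal.mem_asIdeal]
    exact Ideal.Quotient.eq_zero_iff_mem
  have hfinB : Module.Finite k (IdempotentQuotient e) := by
    refine Module.Finite.of_surjective
      (LinearMap.mk (AddHom.mk π fun x y => map_add π x y) fun c x => ?_ :
        A →ₗ[k] IdempotentQuotient e) hπ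
    rfl
  have hB := hasProjectiveDimensionLE_of_kDual (k := k) hπ hker he n hA.gldim_le h_pd
  refine ⟨hfinB, hB, ?_⟩
  refine NuInvStable.of_restrictScalars hk hπ hker he h_str h_ss n hA.gldim_le
    hA.nuInv_iterate_mem hB _ ?_
  exact NuInvStable.single_restrictScalars hπ hker he hA.nuInv_iterate_mem
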